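/- Let $k$ be a field complete with respect to a discrete (non-archimedean) absolute value $|\cdot|$, let $q\in k^\times$ with $|q|<1$, and let $E=k^\times/q^{\mathbb Z}$, identified with the $k$-points of the Tate curve $y^2+xy=x^3+a_4x+a_6$, where $$a_4=\sum_{m\ge1}(-5m^3)\frac{q^m}{1-q^m},\qquad a_6=\sum_{m\ge1}\Bigl(-\frac{5m^3+7m^5}{12}\Bigr)\frac{q^m}{1-q^m},$$ by means of $u\mapsto(x(u),y(u))$ for $u\notin q^{\mathbb Z}$ (and $q^{\mathbb Z}\mapsto$ the point at infinity), with $$x(u)=\sum_{m\in\mathbb Z}\frac{q^mu}{(1-q^mu)^2}-2\sum_{m\ge1}\frac{mq^m}{1-q^m},\qquad y(u)=\sum_{m\in\mathbb Z}\frac{(q^mu)^2}{(1-q^mu)^3}+\sum_{m\ge1}\frac{mq^m}{1-q^m}.$$ Write $\bar\alpha$ for the image of $\alpha\in k^\times$ in $E$. Let $G\subset E$ be a finite subgroup of order $n$ with $\operatorname{char}k\nmid n$, let $E_n$ be the group of $n$-division points of $E$ (so $G\subset E_n$), and let $\gamma\in E_n/G$ be a non-trivial coset. Let $g_1,\dots,g_n,r_1,\dots,r_n\in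 k^\times$ be such that $$G=\{\bar g_1,\dots,\bar g_n\},\qquad \gamma=\{\bar r_1,\dots,\bar r_n\},\qquad \prod_i r_i=\prod_i g_i .$$ Put $\Theta(u)=(1-u^{-1})\prod_{m\ge1}(1-q^mu)(1-q^mu^{-1})$, $\Theta_\alpha(u)=\Theta(\alpha^{-1}u)$ for $\alpha\in k^\times$, and $$f(u)=\prod_{i=1}^n\frac{\Theta_{r_i}(u)}{\Theta_{g_i}(u)} .$$ Then $f$ is $q$-periodic, i.e. $f(qu)=f(u)$, and it defines a (generalized) Jacobi function for $G$ having $\gamma$ as the coset of zeroes. That is, there are a non-zero rational function $R\in k(E)$ on the Tate curve and a character $\chi:G\to k^\times$ such that $f(u)=R(x(u),y(u))$ as functions of $u \in k^\times$, $\operatorname{div}(R)\succcurlyeq-\sum_{g\in G}(g)$, $R(P+g)=\chi(g)R(P)$ for all $g\in G$, and, more precisely, $$\operatorname{div}(R)=-\sum_{P\in G}(P)+\sum_{P\in\gamma}(P),$$ so that $f$ has simple poles at the points of $G$, simple zeroes at the points of $\gamma$, and no other zeroes or poles (also over extension fields of $k$). -/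

import Mathlib

universe u

open Polynomial
open scoped Polynomial.Bivariate

namespace TateJacobi

noncomputable section

/-! ### The Tate curve `E = kˣ / q^ℤ` and its Weierstrass equation -/

section Curve

variable {k : Type u} [NontriviallyNormedField k]

/-- The group of points `E = kˣ / q^ℤ` (written multiplicatively). -/
def E (q : kˣ) : Type u := kˣ ⧸ Subgroup.zpowers q

instance (q : kˣ) : CommGroup (E q) := inferInstanceAs (CommGroup (kˣ ⧸ Subgroup.zpowers q))

/-- The projection of `kˣ` onto `E = kˣ / q^ℤ`. -/
def toE (q : kˣ) : kˣ →* E q := QuotientGroup.mk' (Subgroup.zpowers q)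

/-- The group `E_n` of `n`-division points of `E`. -/
def divisionPoints (q : kˣ) (n : ℕ) : Subgroup (E q) := (powMonoidHom n : E q →* E q).ker

/-- The quotient `E_n / G`. -/
abbrev CosetGroup (q : kˣ) (n : ℕ) (G : Subgroup (E q)) : Type u :=
  divisionPoints q n ⧸ G.subgroupOf (divisionPoints q n)

/-- A coset `γ ∈ E_n / G`, as a set of points of `E`. -/
def cosetPoints {q : kˣ} {n : ℕ} {G : Subgroup (E q)} (γ : CosetGroup q n G) : Set (E q) :=
  {P | ∃ h : P ∈ divisionPoints q n, (QuotientGroup.mk ⟨P, h⟩ : CosetGroup q n G) = γ}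

/-- The coefficient `(5 m ^ 3 + 7 m ^ 5) / 12` of the Weierstrass equation is an integer,
so that it makes sense in every field. -/
theorem twelve_dvd (m : ℕ) : 12 ∣ 5 * m ^ 3 + 7 * m ^ 5 := by
  rw [Nat.dvd_iff_mod_eq_zero, Nat.add_mod, Nat.mul_mod, Nat.pow_mod,
    Nat.mul_mod 7, Nat.pow_mod m 5]
  have h : m % 12 < 12 := Nat.mod_lt _ (by norm_num)
  generalize m % 12 = r at h
  interval_cases r <;> rfl

/-- `a₄ = ∑_{m ≥ 1} (-5 m³) q^m / (1 - q^m)`. -/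
def a₄ (q : k) : k :=
  ∑' m : ℕ, -((5 * (m + 1) ^ 3 : ℕ) : k) * (q ^ (m + 1) / (1 - q ^ (m + 1)))

/-- `a₆ = ∑_{m ≥ 1} (-(5 m³ + 7 m⁵) / 12) q^m / (1 - q^m)`; the division by `12` is carried out
in the integers, where it is exact. -/
def a₆ (q : k) : k :=
  ∑' m : ℕ, -(((5 * (m + 1) ^ 3 + 7 * (m + 1) ^ 5) / 12 : ℕ) : k) *
    (q ^ (m + 1) / (1 - q ^ (m + 1)))

/-- The Tate curve `y² + x y = x³ + a₄ x + a₆`. -/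
def tateCurve (q : k) : WeierstrassCurve.Affine k where
  a₁ := 1
  a₂ := 0
  a₃ := 0
  a₄ := a₄ q
  a₆ := a₆ q

/-- The field `k(E)` of rational functions on the Tate curve. -/
abbrev RationalFunctions (q : k) : Type u := (tateCurve q).FunctionField

/-- The `x`-coordinate of the point of the Tate curve that corresponds to `u ∉ q^ℤ`:
`x(u) = ∑_{m ∈ ℤ} q^m u / (1 - q^m u)² - 2 ∑_{m ≥ 1} m q^m / (1 - q^m)`. -/
def tateX (q u : k) : k :=
  (∑' m : ℤ, q ^ m * u / (1 - q ^ m * u) ^ 2) -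
    2 * ∑' m : ℕ, ((m + 1 : ℕ) : k) * (q ^ (m + 1) / (1 - q ^ (m + 1)))

/-- The `y`-coordinate of the point of the Tate curve that corresponds to `u ∉ q^ℤ`:
`y(u) = ∑_{m ∈ ℤ} (q^m u)² / (1 - q^m u)³ + ∑_{m ≥ 1} m q^m / (1 - q^m)`. -/
def tateY (q u : k) : k :=
  (∑' m : ℤ, (q ^ m * u) ^ 2 / (1 - q ^ m * u) ^ 3) +
    ∑' m : ℕ, ((m + 1 : ℕ) : k) * (q ^ (m + 1) / (1 - q ^ (m + 1)))

end Curve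

/-! ### Rational functions on the Tate curve as functions of the parameter `u`

The points of the curve over a complete extension field `L` of `k` are given by the parameters
`u ∈ Lˣ` modulo `q^ℤ`. Extension fields are needed because the divisor of a rational function
may have points that are not rational over `k`. -/

section Functions

variable {k : Type u} [NontriviallyNormedField k]

/-- The value at `(x, y) ∈ L²` of a polynomial in two variables with coefficients in `k`. -/
def evalAt (L : Type u) [NontriviallyNormedField L] [NormedAlgebra k L]
    (x y : L) (P : k[X][Y]) : L :=
  (P.map (mapRingHom (algebraMap k L))).evalEval x y

/-- `f : L → L`, considered on `Lˣ` only, is the rational function `R ∈ k(E)`, read as a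
(`q`-periodic meromorphic) function of the parameter `u ∈ Lˣ`: the equality `f = R(x(u), y(u))`
holds outside of the zeros of some denominator of `R`, and `f` is meromorphic and in normal form
at all points of `Lˣ` (it has the value `0` at the poles, and no removable singularities); so the
values of `f` on `Lˣ` are determined by `R`. -/
def IsPullback (q : kˣ) (L : Type u) [NontriviallyNormedField L] [NormedAlgebra k L]
    (R : RationalFunctions (q : k)) (f : L → L) : Prop :=
  (∀ α : L, α ≠ 0 → MeromorphicNFAt f α) ∧
  ∃ P Q : k[X][Y],
    WeierstrassCurve.Affine.CoordinateRing.mk (tateCurve (q : k)) Q ≠ 0 ∧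
    R = algebraMap (tateCurve (q : k)).CoordinateRing (RationalFunctions (q : k))
          (WeierstrassCurve.Affine.CoordinateRing.mk (tateCurve (q : k)) P) /
        algebraMap (tateCurve (q : k)).CoordinateRing (RationalFunctions (q : k))
          (WeierstrassCurve.Affine.CoordinateRing.mk (tateCurve (q : k)) Q) ∧
    ∀ u : L, u ≠ 0 → (∀ m : ℤ, u ≠ algebraMap k L q ^ m) →
      evalAt L (tateX (algebraMap k L q) u) (tateY (algebraMap k L q) u) Q ≠ 0 →
      f u = evalAt L (tateX (algebraMap k L q) u) (tateY (algebraMap k L q) u) P /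
            evalAt L (tateX (algebraMap k L q) u) (tateY (algebraMap k L q) u) Q

open Classical in
/-- The coefficient, at the point with parameter `α ∈ Lˣ`, of a divisor `D` that is supported
on the `k`-rational points of `E`. -/
def coeffAt (q : kˣ) (L : Type u) [NontriviallyNormedField L] [NormedAlgebra k L]
    (D : E q → ℤ) (α : L) : ℤ :=
  if h : ∃ u : kˣ, algebraMap k L u = α then D (toE q h.choose) else 0

/-- `div R = D`, for a divisor `D` supported on the `k`-rational points of `E`; the orders are
computed at the points of `E` over all complete extension fields `L` of `k`. -/
def HasDivisor (q : kˣ) (R : RationalFunctions (q : k)) (D : E q → ℤ) : Prop :=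
  ∀ (L : Type u) [NontriviallyNormedField L] [IsUltrametricDist L] [CompleteSpace L]
    [NormedAlgebra k L],
    ∃ f : L → L, IsPullback q L R f ∧
      ∀ α : L, α ≠ 0 → meromorphicOrderAt f α = ((coeffAt q L D α : ℤ) : WithTop ℤ)

/-- `div R ≽ D` or `R = 0`, for a divisor `D` supported on the `k`-rational points of `E`. -/
def DivisorGE (q : kˣ) (R : RationalFunctions (q : k)) (D : E q → ℤ) : Prop :=
  ∀ (L : Type u) [NontriviallyNormedField L] [IsUltrametricDist L] [CompleteSpace L]
    [NormedAlgebra k L],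
    ∃ f : L → L, IsPullback q L R f ∧
      ∀ α : L, α ≠ 0 → ((coeffAt q L D α : ℤ) : WithTop ℤ) ≤ meromorphicOrderAt f α

open Classical in
/-- The divisor `∑_{P ∈ S} (P)` (for a finite set `S` of points of `E`). -/
def sumOfPoints {q : kˣ} (S : Set (E q)) (P : E q) : ℤ := if P ∈ S then 1 else 0

/-- `R ∈ k(E)` is a (generalized) Jacobi function for the finite subgroup `G ⊂ E`, belonging to
the character `χ` of `G`: it is a non-zero element of `𝓛(G)`, i.e. `div R ≽ -∑_{g ∈ G} (g)`, and
`R(u + g) = χ(g) R(u)` for all `g ∈ G` (with the group law of `kˣ / q^ℤ`). -/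
structure IsJacobiFunction (q : kˣ) (G : Subgroup (E q)) (χ : G →* kˣ)
    (R : RationalFunctions (q : k)) : Prop where
  ne_zero : R ≠ 0
  mem_linearSystem : DivisorGE q R (-sumOfPoints (G : Set (E q)))
  translate : ∃ f : k → k, IsPullback q k R f ∧
    ∀ (g : G) (w : kˣ), toE q w = g → ∀ u : kˣ, f (w * u) = (χ g : k) * f u

end Functions

/-! ### Theta functions -/

section Theta

variable {k : Type u} [NontriviallyNormedField k]

/-- The basic theta function `Θ(u) = (1 - u⁻¹) ∏_{m ≥ 1} (1 - q^m u) (1 - q^m u⁻¹)`. -/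
def Theta (q u : k) : k :=
  (1 - u⁻¹) * ∏' m : ℕ, ((1 - q ^ (m + 1) * u) * (1 - q ^ (m + 1) * u⁻¹))

/-- The translate `Θ_α(u) = Θ(α⁻¹ u)`. -/
def ThetaTranslate (q α u : k) : k := Theta q (α⁻¹ * u)

/-- `f(u) = ∏_i Θ_{r_i}(u) / Θ_{g_i}(u)`. As division by zero gives `0`, it has the value `0` at
the points where a denominator vanishes. -/
def thetaQuotient (q : kˣ) {n : ℕ} (r g : Fin n → kˣ) (u : k) : k :=
  ∏ i, ThetaTranslate (q : k) (r i) u / ThetaTranslate (q : k) (g i) u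

end Theta

end

end TateJacobi

set_option linter.unusedSectionVars false

namespace TateJacobi

noncomputable section

/-! ### Laurent series that converge on the whole punctured line -/

section EntireLaurent

/-! `Θ` satisfies `Θ(qu) = -(qu)⁻¹ Θ(u)`, vanishes to first order on `q^ℤ` and has no other zeroes.
Equality of the products of the `r_i` and of the `g_i` therefore makes the automorphy factors of
numerator and denominator of `f` agree, which gives periodicity, and the divisor is visible from the
factors. A lift `w` of a point of `G` permutes the classes of the `r_i` and those of the `g_i`; each
of the two products acquires a constant times `u^N`, where `q^N = w⁻ⁿ` determines `N`. The powers of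
`u` cancel, and the remaining constant is `χ`.

The substance is that `f` is a rational function of `x(u)` and `y(u)`. Everywhere convergent Laurent
series with `a(qX) = c X⁻³ a(X)`, for a fixed `c ≠ 0`, are determined by three consecutive
coefficients, so they form a space of dimension at most 3. With `s = ∑ m q^m / (1 - q^m)`, the
functions `Θ³`, `Θ³ (x + 2s)` and `Θ³ (y - s)` come from series in one such space, and they are
independent because they have different orders at `u = 1`. If `c₁ c₂ c₃ = 1`, then `Θ(c₁u) Θ(c₂u)
Θ(c₃u)` lies there too; hence it is `Θ³` times a linear polynomial in `x, y`, the line through three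
points with sum zero (`exists_mul_Theta_eq`). Combining lines by induction, as in the proof of
Abel's theorem, turns `f` into a quotient of polynomials in `x, y`
(`exists_prod_Theta_eq_prod_Theta`).

The coefficients lie in `k`, and the same identities are evaluated in every complete ultrametric
extension `L`. The polynomials are nonzero on the curve because its coordinate ring is free over
`k[x]` on `1, y`; the argument does not have to verify the Weierstrass equation for `(x(u), y(u))`.

To obtain the series of `Θ² (x + 2s)` and `Θ³ (y - s)`, the sums over `m ≥ 1` are written through
divided derivatives of `e = ∏ (1 - q^m X)`, which work in every characteristic, and are identified
by functional equations under `X ↦ qX`. -/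

/-- The reindexing `(n, m) ↦ (m, n - m)` of double sums. -/
def convolutionEquiv : ℤ × ℤ ≃ ℤ × ℤ :=
  ⟨fun p => (p.2, p.1 - p.2), fun p => (p.1 + p.2, p.1), fun p => by ext <;> simp,
    fun p => by ext <;> simp⟩

theorem tsum_convolution {F : Type*} [NormedAddCommGroup F] [CompleteSpace F] {f : ℤ × ℤ → F}
    (hf : Summable f) : ∑' p, f p = ∑' (n : ℤ) (m : ℤ), f (m, n - m) := by
  rw [← convolutionEquiv.tsum_eq]
  exact (convolutionEquiv.summable_iff.mpr hf).tsum_prod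

theorem summable_convolution {a b : ℤ → ℝ} (ha0 : ∀ n, 0 ≤ a n) (hb0 : ∀ n, 0 ≤ b n)
    (ha : Summable a) (hb : Summable b) :
    Summable fun p : ℤ × ℤ => a p.2 * b (p.1 - p.2) := by
  have h := ha.mul_of_nonneg hb ha0 hb0
  exact (convolutionEquiv.summable_iff (f := fun x : ℤ × ℤ => a x.1 * b x.2)).mpr h

variable (k : Type u) [NontriviallyNormedField k]

/-- The sequences `a : ℤ → k` for which `∑ aₙ uⁿ` converges absolutely for all `u ≠ 0`. -/
def entireLaurentSubmodule : Submodule k (ℤ → k) where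
  carrier := {a | ∀ ρ : ℝ, 0 < ρ → Summable fun n : ℤ => ‖a n‖ * ρ ^ n}
  zero_mem' := by intro ρ _; simp
  add_mem' := by
    intro a b ha hb ρ hρ
    refine Summable.of_nonneg_of_le (fun n => by positivity) (fun n => ?_)
      ((ha ρ hρ).add (hb ρ hρ))
    rw [← add_mul]
    exact mul_le_mul_of_nonneg_right (norm_add_le _ _) (by positivity)
  smul_mem' := by
    intro c a ha ρ hρ
    simpa [mul_assoc] using (ha ρ hρ).mul_left ‖c‖

/-- Laurent series with coefficients in `k` that converge on the whole punctured line. -/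
def EntireLaurent : Type u := ↥(entireLaurentSubmodule k)

instance : AddCommGroup (EntireLaurent k) :=
  inferInstanceAs (AddCommGroup ↥(entireLaurentSubmodule k))
instance : Module k (EntireLaurent k) := inferInstanceAs (Module k ↥(entireLaurentSubmodule k))

variable {k}

namespace EntireLaurent

/-- The coefficients of a Laurent series. -/
def coeff (a : EntireLaurent k) (n : ℤ) : k := a.1 n

@[ext] theorem ext {a b : EntireLaurent k} (h : ∀ n, a.coeff n = b.coeff n) : a = b :=
  Subtype.ext (funext h)

theorem summable_norm (a : EntireLaurent k) {ρ : ℝ} (hρ : 0 < ρ) :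
    Summable fun n : ℤ => ‖a.coeff n‖ * ρ ^ n := a.2 ρ hρ

theorem summable_norm_coeff (a : EntireLaurent k) : Summable fun n : ℤ => ‖a.coeff n‖ := by
  simpa using a.summable_norm one_pos

@[simp] theorem coeff_zero (n : ℤ) : (0 : EntireLaurent k).coeff n = 0 := rfl
@[simp] theorem coeff_add (a b : EntireLaurent k) (n : ℤ) :
    (a + b).coeff n = a.coeff n + b.coeff n := rfl
@[simp] theorem coeff_neg (a : EntireLaurent k) (n : ℤ) : (-a).coeff n = -a.coeff n := rfl
@[simp] theorem coeff_smul (c : k) (a : EntireLaurent k) (n : ℤ) :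
    (c • a).coeff n = c * a.coeff n := rfl

/-- The monomial `c Xⁿ`. -/
def single (n : ℤ) (c : k) : EntireLaurent k :=
  ⟨Pi.single n c, fun ρ _ => summable_of_ne_finset_zero (s := {n}) fun m hm => by
    simp [Pi.single_eq_of_ne (Finset.notMem_singleton.mp hm)]⟩

theorem coeff_single (n : ℤ) (c : k) (m : ℤ) :
    (single n c).coeff m = if m = n then c else 0 := by
  simp [single, coeff, Pi.single_apply]

variable [CompleteSpace k]

theorem summable_mul (a b : EntireLaurent k) (n : ℤ) :
    Summable fun m => a.coeff m * b.coeff (n - m) := by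
  refine Summable.of_norm ?_
  simpa using (summable_convolution (fun n => norm_nonneg _) (fun n => norm_nonneg _)
    a.summable_norm_coeff b.summable_norm_coeff).prod_factor n

instance : Mul (EntireLaurent k) where
  mul a b := ⟨fun n => ∑' m, a.coeff m * b.coeff (n - m), by
    intro ρ hρ
    have h := summable_convolution (a := fun n => ‖a.coeff n‖ * ρ ^ n)
      (b := fun n => ‖b.coeff n‖ * ρ ^ n) (fun n => by positivity) (fun n => by positivity)
      (a.summable_norm hρ) (b.summable_norm hρ)
    refine Summable.of_nonneg_of_le (fun n => by positivity) (fun n => ?_) h.prod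
    have h1 : ∀ m, ‖a.coeff m‖ * ρ ^ m * (‖b.coeff (n - m)‖ * ρ ^ (n - m)) =
        ‖a.coeff m * b.coeff (n - m)‖ * ρ ^ n := by
      intro m
      have : ρ ^ n = ρ ^ m * ρ ^ (n - m) := by rw [← zpow_add₀ hρ.ne']; congr 1; ring
      rw [norm_mul, this]; ring
    simp only [h1, tsum_mul_right]
    refine mul_le_mul_of_nonneg_right (norm_tsum_le_tsum_norm ?_) (by positivity)
    simpa using (summable_convolution (fun n => norm_nonneg _) (fun n => norm_nonneg _)
      a.summable_norm_coeff b.summable_norm_coeff).prod_factor n⟩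

theorem coeff_mul (a b : EntireLaurent k) (n : ℤ) :
    (a * b).coeff n = ∑' m, a.coeff m * b.coeff (n - m) := rfl

theorem coeff_single_mul (m : ℤ) (c : k) (a : EntireLaurent k) (n : ℤ) :
    (single m c * a).coeff n = c * a.coeff (n - m) := by
  rw [coeff_mul, tsum_eq_single m]
  · simp [coeff_single]
  · intro j hj; simp [coeff_single, hj]

instance : One (EntireLaurent k) := ⟨single 0 1⟩

theorem one_def : (1 : EntireLaurent k) = single 0 1 := rfl

protected theorem mul_comm (a b : EntireLaurent k) : a * b = b * a := by
  ext n
  rw [coeff_mul, coeff_mul, ← (Equiv.subLeft n).tsum_eq]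
  simp [mul_comm]

protected theorem mul_assoc (a b c : EntireLaurent k) : a * b * c = a * (b * c) := by
  ext n
  have hs : Summable fun p : ℤ × ℤ => a.coeff p.1 * b.coeff p.2 * c.coeff (n - p.1 - p.2) := by
    -- Boundedness of the third factor is enough: the first two already give an absolutely
    -- convergent double series.
    obtain ⟨M, hM⟩ : ∃ M, ∀ m, ‖c.coeff m‖ ≤ M :=
      ⟨_, fun m => c.summable_norm_coeff.le_tsum m fun _ _ => norm_nonneg _⟩
    refine Summable.of_norm_bounded
      ((a.summable_norm_coeff.mul_of_nonneg b.summable_norm_coeff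
        (fun _ => norm_nonneg _) fun _ => norm_nonneg _).mul_right M) fun p => ?_
    rw [norm_mul, norm_mul]
    exact mul_le_mul_of_nonneg_left (hM _) (by positivity)
  calc (a * b * c).coeff n
      = ∑' m, ∑' i, a.coeff i * b.coeff (m - i) * c.coeff (n - i - (m - i)) := by
        rw [coeff_mul]
        refine tsum_congr fun m => ?_
        rw [coeff_mul, ← tsum_mul_right]
        refine tsum_congr fun i => ?_
        congr 2; ring
    _ = ∑' p : ℤ × ℤ, a.coeff p.1 * b.coeff p.2 * c.coeff (n - p.1 - p.2) := by
        rw [tsum_convolution hs]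
    _ = (a * (b * c)).coeff n := by
        rw [hs.tsum_prod, coeff_mul]
        refine tsum_congr fun i => ?_
        rw [coeff_mul, ← tsum_mul_left]
        exact tsum_congr fun j => by ring

protected theorem one_mul (a : EntireLaurent k) : 1 * a = a := by
  ext n
  rw [one_def, coeff_single_mul]; simp

protected theorem left_distrib (a b c : EntireLaurent k) : a * (b + c) = a * b + a * c := by
  ext n
  rw [coeff_add, coeff_mul, coeff_mul, coeff_mul,
    ← (a.summable_mul b n).tsum_add (a.summable_mul c n)]
  exact tsum_congr fun m => by rw [coeff_add]; ring

instance : CommRing (EntireLaurent k) :=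
  { (inferInstance : AddCommGroup (EntireLaurent k)) with
    mul_comm := EntireLaurent.mul_comm
    mul_assoc := EntireLaurent.mul_assoc
    one_mul := EntireLaurent.one_mul
    mul_one := fun a => by rw [EntireLaurent.mul_comm, EntireLaurent.one_mul]
    left_distrib := EntireLaurent.left_distrib
    right_distrib := fun a b c => by
      rw [EntireLaurent.mul_comm, EntireLaurent.left_distrib, EntireLaurent.mul_comm c a,
        EntireLaurent.mul_comm c b]
    zero_mul := fun a => by ext n; simp [coeff_mul]
    mul_zero := fun a => by ext n; simp [coeff_mul] }

protected theorem smul_mul (c : k) (a b : EntireLaurent k) : c • a * b = c • (a * b) := by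
  ext n
  rw [coeff_smul, coeff_mul, coeff_mul, ← tsum_mul_left]
  exact tsum_congr fun m => by rw [coeff_smul]; ring

instance : Algebra k (EntireLaurent k) :=
  Algebra.ofModule EntireLaurent.smul_mul fun c a b => by
    rw [mul_comm, EntireLaurent.smul_mul, mul_comm]

theorem single_mul_single (m n : ℤ) (c d : k) :
    single m c * single n d = single (m + n) (c * d) := by
  ext j
  rw [coeff_single_mul, coeff_single, coeff_single]
  by_cases h : j = m + n
  · simp [h]
  · rw [if_neg h, if_neg (by omega), mul_zero]

/-- The substitution `X ↦ c X`. -/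
def dilate (c : kˣ) : EntireLaurent k →+* EntireLaurent k where
  toFun a := ⟨fun n => (c : k) ^ n * a.coeff n, fun ρ hρ => by
    have := a.summable_norm (mul_pos (norm_pos_iff.mpr c.ne_zero) hρ)
    refine this.congr fun n => ?_
    rw [norm_mul, norm_zpow, mul_zpow]; ring⟩
  map_one' := by
    ext n
    change (c : k) ^ n * (single 0 1 : EntireLaurent k).coeff n = (single 0 1).coeff n
    rw [coeff_single]; split_ifs with h <;> simp [h]
  map_zero' := by ext n; exact mul_zero _
  map_add' a b := by ext n; exact mul_add _ _ _
  map_mul' a b := by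
    ext n
    change (c : k) ^ n * ∑' m, a.coeff m * b.coeff (n - m) =
      ∑' m, ((c : k) ^ m * a.coeff m) * ((c : k) ^ (n - m) * b.coeff (n - m))
    rw [← tsum_mul_left]
    refine tsum_congr fun m => ?_
    rw [zpow_sub₀ c.ne_zero]
    field_simp

theorem coeff_dilate (c : kˣ) (a : EntireLaurent k) (n : ℤ) :
    (dilate c a).coeff n = (c : k) ^ n * a.coeff n := rfl

/-- The substitution `X ↦ X⁻¹`. -/
def invert : EntireLaurent k →+* EntireLaurent k where
  toFun a := ⟨fun n => a.coeff (-n), fun ρ hρ => by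
    have := (Equiv.neg ℤ).summable_iff.mpr (a.summable_norm (inv_pos.mpr hρ))
    refine this.congr fun n => ?_
    simp⟩
  map_one' := by
    ext n
    change (single 0 1 : EntireLaurent k).coeff (-n) = (single 0 1).coeff n
    rw [coeff_single, coeff_single]; simp
  map_zero' := rfl
  map_add' a b := rfl
  map_mul' a b := by
    ext n
    change ∑' m, a.coeff m * b.coeff (-n - m) = ∑' m, a.coeff (-m) * b.coeff (-(n - m))
    rw [← (Equiv.neg ℤ).tsum_eq]
    refine tsum_congr fun m => ?_
    simp only [Equiv.neg_apply]
    congr 2; ring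

theorem coeff_invert (a : EntireLaurent k) (n : ℤ) : (invert a).coeff n = a.coeff (-n) := rfl

theorem dilate_single (c : kˣ) (n : ℤ) (d : k) :
    dilate c (single n d) = single n ((c : k) ^ n * d) := by
  ext m; rw [coeff_dilate, coeff_single, coeff_single]; split_ifs with h <;> simp [h]

theorem invert_single (n : ℤ) (d : k) : invert (single n d) = single (-n) d := by
  ext m; rw [coeff_invert, coeff_single, coeff_single]
  by_cases h : m = -n
  · simp [h]
  · rw [if_neg h, if_neg (by omega)]

theorem dilate_dilate (c d : kˣ) (a : EntireLaurent k) :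
    dilate c (dilate d a) = dilate (c * d) a := by
  ext n; simp [coeff_dilate, mul_zpow, mul_assoc]

theorem dilate_one (a : EntireLaurent k) : dilate 1 a = a := by
  ext n; simp [coeff_dilate]

theorem invert_dilate (c : kˣ) (a : EntireLaurent k) :
    invert (dilate c a) = dilate c⁻¹ (invert a) := by
  ext n; simp [coeff_dilate, coeff_invert]

theorem dilate_smul (c : kˣ) (d : k) (a : EntireLaurent k) :
    dilate c (d • a) = d • dilate c a := by
  ext n; simp only [coeff_dilate, coeff_smul]; ring

variable {L : Type*} [NontriviallyNormedField L] [NormedAlgebra k L]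

theorem summable_norm_eval (a : EntireLaurent k) (u : Lˣ) :
    Summable fun n : ℤ => ‖algebraMap k L (a.coeff n) * (u : L) ^ n‖ := by
  refine (a.summable_norm (norm_pos_iff.mpr u.ne_zero)).congr fun n => ?_
  rw [norm_mul, norm_zpow, norm_algebraMap']

variable [CompleteSpace L]

/-- The value of a Laurent series. -/
def eval (u : Lˣ) : EntireLaurent k →+* L where
  toFun a := ∑' n : ℤ, algebraMap k L (a.coeff n) * (u : L) ^ n
  map_one' := by
    rw [tsum_eq_single 0]
    · simp [one_def, coeff_single]
    · intro n hn; simp [one_def, coeff_single, hn]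
  map_zero' := by simp
  map_add' a b := by
    rw [← (a.summable_norm_eval u).of_norm.tsum_add (b.summable_norm_eval u).of_norm]
    exact tsum_congr fun n => by simp [add_mul]
  map_mul' a b := by
    have hs := (a.summable_norm_eval u).mul_norm (b.summable_norm_eval u)
    rw [tsum_mul_tsum_of_summable_norm (a.summable_norm_eval u) (b.summable_norm_eval u),
      tsum_convolution hs.of_norm]
    refine tsum_congr fun n => ?_
    have h1 : algebraMap k L ((a * b).coeff n) =
        ∑' m, algebraMap k L (a.coeff m * b.coeff (n - m)) :=
      ((a.summable_mul b n).hasSum.mapL (algebraMapCLM k L)).tsum_eq.symm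
    rw [h1, ← tsum_mul_right]
    refine tsum_congr fun m => ?_
    change _ = (algebraMap k L (a.coeff m) * (u : L) ^ m) *
      (algebraMap k L (b.coeff (n - m)) * (u : L) ^ (n - m))
    rw [zpow_sub₀ u.ne_zero, map_mul]
    field_simp

theorem eval_apply (u : Lˣ) (a : EntireLaurent k) :
    eval u a = ∑' n : ℤ, algebraMap k L (a.coeff n) * (u : L) ^ n := rfl

theorem eval_single (u : Lˣ) (n : ℤ) (c : k) :
    eval u (single n c) = algebraMap k L c * (u : L) ^ n := by
  rw [eval_apply, tsum_eq_single n]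
  · simp [coeff_single]
  · intro m hm; simp [coeff_single, hm]

theorem eval_smul (u : Lˣ) (c : k) (a : EntireLaurent k) :
    eval u (c • a) = algebraMap k L c * eval u a := by
  rw [eval_apply, eval_apply, ← tsum_mul_left]
  exact tsum_congr fun n => by rw [coeff_smul, map_mul, mul_assoc]

theorem eval_dilate (u : Lˣ) (c : kˣ) (a : EntireLaurent k) :
    eval u (dilate c a) = eval (Units.map (algebraMap k L).toMonoidHom c * u) a := by
  rw [eval_apply, eval_apply]
  refine tsum_congr fun n => ?_
  rw [coeff_dilate]
  simp [mul_zpow]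
  ring

theorem eval_invert (u : Lˣ) (a : EntireLaurent k) : eval u (invert a) = eval u⁻¹ a := by
  rw [eval_apply, eval_apply, ← (Equiv.neg ℤ).tsum_eq]
  exact tsum_congr fun n => by simp [coeff_invert]

end EntireLaurent

end EntireLaurent

/-! ### Theta series -/

section ThetaSeries

open Filter Topology

variable {k : Type u} [NontriviallyNormedField k]

namespace EntireLaurent

/-- An everywhere convergent power series, as a Laurent series. -/
def ofPowerSeries (b : ℕ → k) (hb : ∀ ρ : ℝ, 0 < ρ → Summable fun n : ℕ => ‖b n‖ * ρ ^ n) :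
    EntireLaurent k :=
  ⟨fun n => if 0 ≤ n then b n.toNat else 0, fun ρ hρ => by
    rw [← (Nat.cast_injective (R := ℤ)).summable_iff]
    · exact (hb ρ hρ).congr fun n => by simp
    · intro n hn
      have : ¬ 0 ≤ n := fun h => hn ⟨n.toNat, by simp [h]⟩
      simp [this]⟩

theorem coeff_ofPowerSeries_natCast (b : ℕ → k)
    (hb : ∀ ρ : ℝ, 0 < ρ → Summable fun n : ℕ => ‖b n‖ * ρ ^ n) (n : ℕ) :
    (ofPowerSeries b hb).coeff n = b n := by
  simp [ofPowerSeries, coeff]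

theorem coeff_ofPowerSeries_of_neg (b : ℕ → k)
    (hb : ∀ ρ : ℝ, 0 < ρ → Summable fun n : ℕ => ‖b n‖ * ρ ^ n) {n : ℤ} (hn : n < 0) :
    (ofPowerSeries b hb).coeff n = 0 := by
  simp [ofPowerSeries, coeff, hn]

theorem eval_ofPowerSeries [CompleteSpace k] {L : Type*} [NontriviallyNormedField L]
    [NormedAlgebra k L] [CompleteSpace L] (b : ℕ → k)
    (hb : ∀ ρ : ℝ, 0 < ρ → Summable fun n : ℕ => ‖b n‖ * ρ ^ n) (u : Lˣ) :
    eval u (ofPowerSeries b hb) = ∑' n : ℕ, algebraMap k L (b n) * (u : L) ^ n := by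
  rw [eval_apply, ← (Nat.cast_injective (R := ℤ)).tsum_eq]
  · exact tsum_congr fun n => by rw [coeff_ofPowerSeries_natCast, zpow_natCast]
  · intro n hn
    by_contra h
    have hn0 : n < 0 := not_le.mp fun h' => h ⟨n.toNat, by simp [h']⟩
    exact hn (by simp [coeff_ofPowerSeries_of_neg b hb hn0])

variable [CompleteSpace k]

/-! ### Dimension bound for theta functions of degree `d`. -/

/-- The Laurent series `a` with `a(qX) = c X⁻ᵈ a(X)`. -/
def quasiPeriodic (q : kˣ) (d : ℕ) (c : k) : Submodule k (EntireLaurent k) where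
  carrier := {a | dilate q a = single (-d) c * a}
  zero_mem' := by simp
  add_mem' := by
    intro a b (ha : _ = _) (hb : _ = _)
    change dilate q (a + b) = _
    rw [map_add, ha, hb, mul_add]
  smul_mem' := by
    intro t a (ha : _ = _)
    change dilate q (t • a) = _
    rw [dilate_smul, ha, mul_smul_comm]

/-- Comparing coefficients gives `qⁿ aₙ = c aₙ₊d`, so the coefficients in one residue class modulo
`d` vanish together. -/
theorem eq_zero_of_mem_quasiPeriodic {q : kˣ} {d : ℕ} (hd : d ≠ 0) {c : k} (hc : c ≠ 0)
    {a : EntireLaurent k} (ha : a ∈ quasiPeriodic q d c) (h0 : ∀ i : Fin d, a.coeff i = 0) :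
    a = 0 := by
  have hrec : ∀ n : ℤ, a.coeff n = 0 ↔ a.coeff (n + d) = 0 := by
    intro n
    have h : (dilate q a).coeff n = (single (-d) c * a).coeff n := congrArg (fun b => coeff b n) ha
    rw [coeff_dilate, coeff_single_mul, sub_neg_eq_add] at h
    constructor
    · intro h'
      rw [h', mul_zero] at h
      exact (mul_eq_zero.mp h.symm).resolve_left hc
    · intro h'
      rw [h', mul_zero] at h
      exact (mul_eq_zero.mp h).resolve_left (zpow_ne_zero _ q.ne_zero)
  have hrec' : ∀ (j n : ℤ), a.coeff n = 0 ↔ a.coeff (n + d * j) = 0 := by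
    intro j
    induction j with
    | zero => simp
    | succ i ih => intro n; rw [ih, hrec]; ring_nf
    | pred i ih => intro n; rw [hrec (n + _), ih]; ring_nf
  ext n
  have hd' : (0 : ℤ) < d := by positivity
  have h1 := h0 ⟨(n % d).toNat, by have := Int.emod_lt_of_pos n hd'; omega⟩
  rw [hrec' (n / d)] at h1
  simpa [Int.emod_nonneg n hd'.ne', Int.emod_add_mul_ediv] using h1

/-- Reading off the coefficients `0, …, d - 1` embeds the space into `kᵈ`, so any `d` independent
members span it. -/
theorem exists_eq_sum_of_mem_quasiPeriodic {q : kˣ} {d : ℕ} (hd : d ≠ 0) {c : k} (hc : c ≠ 0)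
    {v : Fin d → EntireLaurent k} (hv : ∀ i, v i ∈ quasiPeriodic q d c)
    (hli : ∀ t : Fin d → k, ∑ i, t i • v i = 0 → ∀ i, t i = 0)
    {w : EntireLaurent k} (hw : w ∈ quasiPeriodic q d c) : ∃ t : Fin d → k, w = ∑ i, t i • v i := by
  let φ : EntireLaurent k →ₗ[k] (Fin d → k) :=
    { toFun := fun a i => a.coeff i
      map_add' := fun _ _ => rfl
      map_smul' := fun _ _ => rfl }
  have hφ : ∀ a ∈ quasiPeriodic q d c, φ a = 0 → a = 0 := fun a ha h =>
    eq_zero_of_mem_quasiPeriodic hd hc ha fun i => congrFun h i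
  have hind : LinearIndependent k fun i => φ (v i) := by
    rw [Fintype.linearIndependent_iff]
    intro t ht
    refine hli t (hφ _ (Submodule.sum_smul_mem _ _ fun i _ => hv i) ?_)
    simpa using ht
  have hspan := hind.span_eq_top_of_card_eq_finrank' (by simp)
  have hmem : φ w ∈ Submodule.span k (Set.range fun i => φ (v i)) := hspan ▸ Submodule.mem_top
  obtain ⟨t, ht⟩ := (Submodule.mem_span_range_iff_exists_fun k).mp hmem
  refine ⟨t, ?_⟩
  rw [← sub_eq_zero]
  refine hφ _ (Submodule.sub_mem _ hw (Submodule.sum_smul_mem _ _ fun i _ => hv i)) ?_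
  simp [← ht]

end EntireLaurent

/-! ### The product `e = ∏ (1 - q^m X)` and its divided derivatives. -/

/-- The coefficients of the power series `∏_{m ≥ 1} (1 - q^m X)`. -/
def eulerCoeff (q : k) : ℕ → k
  | 0 => 1
  | n + 1 => -(q ^ (n + 1) / (1 - q ^ (n + 1))) * eulerCoeff q n

variable {q : kˣ}

theorem one_sub_pow_ne_zero {q : k} (hq : ‖q‖ < 1) (n : ℕ) : 1 - q ^ (n + 1) ≠ 0 := by
  intro h
  have h1 : ‖q ^ (n + 1)‖ = 1 := by rw [← sub_eq_zero.mp h]; simp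
  rw [norm_pow] at h1
  exact (pow_lt_one₀ (norm_nonneg _) hq n.succ_ne_zero).ne h1

/-- This is the coefficient of `Xⁿ⁺¹` in `e(X) = (1 - qX) e(qX)`. -/
theorem eulerCoeff_succ {q : k} (hq : ‖q‖ < 1) (n : ℕ) :
    eulerCoeff q (n + 1) = q ^ (n + 1) * eulerCoeff q (n + 1) - q ^ (n + 1) * eulerCoeff q n := by
  have h := one_sub_pow_ne_zero hq n
  rw [eulerCoeff]
  field_simp
  ring

theorem eulerCoeff_ne_zero (hq : ‖(q : k)‖ < 1) (n : ℕ) : eulerCoeff (q : k) n ≠ 0 := by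
  induction n with
  | zero => exact one_ne_zero
  | succ n ih =>
    exact mul_ne_zero (neg_ne_zero.mpr (div_ne_zero (pow_ne_zero _ q.ne_zero)
      (one_sub_pow_ne_zero hq n))) ih

theorem summable_eulerCoeff (hq : ‖(q : k)‖ < 1) {ρ : ℝ} (hρ : 0 < ρ) :
    Summable fun n : ℕ => ‖eulerCoeff (q : k) n‖ * ρ ^ n := by
  refine summable_of_ratio_test_tendsto_lt_one (l := 0) one_pos (Eventually.of_forall fun n =>
    (mul_pos (norm_pos_iff.mpr (eulerCoeff_ne_zero hq n)) (pow_pos hρ n)).ne') ?_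
  have hqn : Tendsto (fun n : ℕ => (q : k) ^ (n + 1)) atTop (𝓝 0) :=
    (tendsto_pow_atTop_nhds_zero_of_norm_lt_one hq).comp (tendsto_add_atTop_nat 1)
  have h1 : Tendsto (fun n : ℕ => ‖(q : k) ^ (n + 1) / (1 - (q : k) ^ (n + 1))‖ * ρ) atTop
      (𝓝 0) := by
    have := ((hqn.div (hqn.const_sub 1) (by simp)).norm).mul_const ρ
    simpa using this
  refine h1.congr fun n => ?_
  have h2 := norm_pos_iff.mpr (eulerCoeff_ne_zero hq n)
  rw [eulerCoeff, norm_mul (-_), norm_neg]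
  simp only [norm_mul, norm_norm, norm_pow, Real.norm_of_nonneg hρ.le]
  field_simp
  ring

variable [IsUltrametricDist k]

theorem summable_choose_mul_eulerCoeff (hq : ‖(q : k)‖ < 1) (i : ℕ) (ρ : ℝ) (hρ : 0 < ρ) :
    Summable fun n : ℕ => ‖(n.choose i : k) * eulerCoeff (q : k) n‖ * ρ ^ n := by
  refine Summable.of_nonneg_of_le (fun n => by positivity) (fun n => ?_)
    (summable_eulerCoeff hq hρ)
  refine mul_le_mul_of_nonneg_right ?_ (by positivity)
  rw [norm_mul]
  exact mul_le_of_le_one_left (norm_nonneg _) (IsUltrametricDist.norm_natCast_le_one k _)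

open EntireLaurent

/-- `Xⁱ` times the `i`-th divided derivative of the power series `∏_{m ≥ 1} (1 - q^m X)`. -/
def eulerSeries (hq : ‖(q : k)‖ < 1) (i : ℕ) : EntireLaurent k :=
  ofPowerSeries _ (summable_choose_mul_eulerCoeff hq i)

variable [CompleteSpace k] (hq : ‖(q : k)‖ < 1)

theorem eulerSeries_zero :
    eulerSeries hq 0 = (1 - single 1 (q : k)) * dilate q (eulerSeries hq 0) := by
  ext n
  rw [sub_mul, one_mul, sub_eq_add_neg, EntireLaurent.coeff_add, EntireLaurent.coeff_neg,
    coeff_single_mul, coeff_dilate, coeff_dilate]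
  rcases lt_or_ge n 0 with hn | hn
  · rw [eulerSeries, coeff_ofPowerSeries_of_neg _ _ hn,
      coeff_ofPowerSeries_of_neg _ _ (by omega : n - 1 < 0)]; simp
  obtain ⟨n, rfl⟩ := Int.eq_ofNat_of_zero_le hn
  rcases n with _ | n
  · rw [eulerSeries, coeff_ofPowerSeries_natCast,
      coeff_ofPowerSeries_of_neg _ _ (by simp : ((0 : ℕ) : ℤ) - 1 < 0)]; simp
  · have h1 : ((n + 1 : ℕ) : ℤ) - 1 = (n : ℕ) := by simp
    rw [h1, eulerSeries, coeff_ofPowerSeries_natCast, coeff_ofPowerSeries_natCast, zpow_natCast,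
      zpow_natCast]
    have := eulerCoeff_succ hq n
    simp only [Nat.choose_zero_right, Nat.cast_one, one_mul]
    linear_combination this

/-- The Leibniz rule for divided derivatives applied to `(1 - qX) e(qX)`: the first factor is
linear, so only two terms survive. On coefficients it is Pascal's rule. -/
theorem eulerSeries_succ (i : ℕ) :
    eulerSeries hq (i + 1) = (1 - single 1 (q : k)) * dilate q (eulerSeries hq (i + 1)) -
      single 1 (q : k) * dilate q (eulerSeries hq i) := by
  ext n
  rw [sub_mul, one_mul, sub_eq_add_neg, sub_eq_add_neg, EntireLaurent.coeff_add,
    EntireLaurent.coeff_add, EntireLaurent.coeff_neg, EntireLaurent.coeff_neg,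
    coeff_single_mul, coeff_single_mul, coeff_dilate, coeff_dilate, coeff_dilate]
  rcases lt_or_ge n 0 with hn | hn
  · rw [eulerSeries, eulerSeries, coeff_ofPowerSeries_of_neg _ _ hn,
      coeff_ofPowerSeries_of_neg _ _ (by omega : n - 1 < 0),
      coeff_ofPowerSeries_of_neg _ _ (by omega : n - 1 < 0)]; simp
  obtain ⟨n, rfl⟩ := Int.eq_ofNat_of_zero_le hn
  rcases n with _ | n
  · rw [eulerSeries, eulerSeries, coeff_ofPowerSeries_natCast,
      coeff_ofPowerSeries_of_neg _ _ (by simp : ((0 : ℕ) : ℤ) - 1 < 0),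
      coeff_ofPowerSeries_of_neg _ _ (by simp : ((0 : ℕ) : ℤ) - 1 < 0)]; simp
  · have h1 : ((n + 1 : ℕ) : ℤ) - 1 = (n : ℕ) := by simp
    rw [h1, eulerSeries, eulerSeries, coeff_ofPowerSeries_natCast, coeff_ofPowerSeries_natCast,
      coeff_ofPowerSeries_natCast, zpow_natCast, zpow_natCast]
    have := eulerCoeff_succ hq n
    rw [Nat.choose_succ_succ, Nat.cast_add]
    linear_combination ((n.choose i : k) + (n.choose (i + 1) : k)) * this

/-- The series of `(1 - X⁻¹) ∏_{m ≥ 1} (1 - q^m X) (1 - q^m X⁻¹)`. -/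
def thetaSeries : EntireLaurent k :=
  (1 - single (-1) 1) * eulerSeries hq 0 * invert (eulerSeries hq 0)

/-! ### The sums over `m ≥ 1` with their denominators cleared. -/

/-- The series of `e² ∑_{m ≥ 1} t / (1 - t)²`, where `t = q^m X` and `e = ∏_{m ≥ 1} (1 - q^m X)`. -/
def eulerSqSeries : EntireLaurent k :=
  -eulerSeries hq 0 * eulerSeries hq 1 + eulerSeries hq 1 ^ 2 -
    2 * (eulerSeries hq 0 * eulerSeries hq 2)

/-- The series of `e³ ∑_{m ≥ 1} t² / (1 - t)³`, where `t = q^m X` and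
`e = ∏_{m ≥ 1} (1 - q^m X)`. -/
def eulerCubeSeries : EntireLaurent k :=
  eulerSeries hq 0 * eulerSeries hq 1 ^ 2 - 2 * (eulerSeries hq 0 ^ 2 * eulerSeries hq 2) -
    eulerSeries hq 1 ^ 3 + 3 * (eulerSeries hq 0 * eulerSeries hq 1 * eulerSeries hq 2) -
    3 * (eulerSeries hq 0 ^ 2 * eulerSeries hq 3)

/-- The series of `e³ ∑_{m ≥ 1} t / (1 - t)³`, where `t = q^m X` and
`e = ∏_{m ≥ 1} (1 - q^m X)`. -/
def eulerCubeSeries' : EntireLaurent k :=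
  eulerCubeSeries hq + eulerSeries hq 0 * eulerSqSeries hq

/-- With `δ = X d/dX`, the series is `-e² δ² log e`, and the factor `1 - t` contributes `-δ² log (1
- t) = t / (1 - t)²`. This equation splits off the term `m = 1`; it is what later identifies the
sum. -/
theorem eulerSqSeries_eq :
    eulerSqSeries hq = single 1 (q : k) * dilate q (eulerSeries hq 0) ^ 2 +
      (1 - single 1 (q : k)) ^ 2 * dilate q (eulerSqSeries hq) := by
  have h0 := eulerSeries_zero hq
  have h1 := eulerSeries_succ hq 0
  have h2 := eulerSeries_succ hq 1
  simp only [zero_add, Nat.reduceAdd] at h1 h2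
  simp only [eulerSqSeries, map_add, map_sub, map_mul, map_neg, map_pow, map_ofNat]
  generalize dilate q (eulerSeries hq 0) = s0 at *
  generalize dilate q (eulerSeries hq 1) = s1 at *
  generalize dilate q (eulerSeries hq 2) = s2 at *
  rw [h0, h1, h2]
  ring

/-- Here `t² / (1 - t)³` is one half of `δ - 1` applied to `t / (1 - t)²`; the half is absorbed by
the divided derivatives. -/
theorem eulerCubeSeries_eq :
    eulerCubeSeries hq = single 1 (q : k) ^ 2 * dilate q (eulerSeries hq 0) ^ 3 +
      (1 - single 1 (q : k)) ^ 3 * dilate q (eulerCubeSeries hq) := by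
  have h0 := eulerSeries_zero hq
  have h1 := eulerSeries_succ hq 0
  have h2 := eulerSeries_succ hq 1
  have h3 := eulerSeries_succ hq 2
  simp only [zero_add, Nat.reduceAdd] at h1 h2 h3
  simp only [eulerCubeSeries, map_add, map_sub, map_mul, map_pow, map_ofNat]
  generalize dilate q (eulerSeries hq 0) = s0 at *
  generalize dilate q (eulerSeries hq 1) = s1 at *
  generalize dilate q (eulerSeries hq 2) = s2 at *
  generalize dilate q (eulerSeries hq 3) = s3 at *
  rw [h0, h1, h2, h3]
  ring

theorem eulerCubeSeries'_eq :
    eulerCubeSeries' hq = single 1 (q : k) * dilate q (eulerSeries hq 0) ^ 3 +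
      (1 - single 1 (q : k)) ^ 3 * dilate q (eulerCubeSeries' hq) := by
  have h0 := eulerSeries_zero hq
  have h2 := eulerSqSeries_eq hq
  have h3 := eulerCubeSeries_eq hq
  rw [eulerCubeSeries', map_add, map_mul]
  generalize dilate q (eulerSeries hq 0) = s0 at *
  generalize dilate q (eulerSqSeries hq) = s2 at *
  generalize dilate q (eulerCubeSeries hq) = s3 at *
  rw [h0, h2, h3]
  ring

/-- Serves to read the functional equations at `(qX)⁻¹`, where `qX` becomes `X⁻¹` and the product
over negative powers gains the factor `1 - X⁻¹`. -/
theorem dilate_invert (a : EntireLaurent k) : dilate q (invert (dilate q a)) = invert a := by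
  rw [invert_dilate, dilate_dilate, mul_inv_cancel, dilate_one]

theorem dilate_invert_single : dilate q (invert (single 1 (q : k))) = single (-1) 1 := by
  rw [invert_single, dilate_single]; simp

theorem dilate_invert_eulerSeries : dilate q (invert (eulerSeries hq 0)) =
    (1 - single (-1) 1) * invert (eulerSeries hq 0) := by
  conv_lhs => rw [eulerSeries_zero]
  rw [map_mul, map_mul, dilate_invert, map_sub, map_sub, dilate_invert_single, map_one, map_one]

theorem dilate_invert_eulerSqSeries : dilate q (invert (eulerSqSeries hq)) =
    single (-1) 1 * invert (eulerSeries hq 0) ^ 2 +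
      (1 - single (-1) 1) ^ 2 * invert (eulerSqSeries hq) := by
  conv_lhs => rw [eulerSqSeries_eq]
  simp only [map_mul, map_add, map_pow, map_sub, map_one, dilate_invert, dilate_invert_single]

theorem dilate_invert_eulerCubeSeries' : dilate q (invert (eulerCubeSeries' hq)) =
    single (-1) 1 * invert (eulerSeries hq 0) ^ 3 +
      (1 - single (-1) 1) ^ 3 * invert (eulerCubeSeries' hq) := by
  conv_lhs => rw [eulerCubeSeries'_eq]
  simp only [map_mul, map_add, map_pow, map_sub, map_one, dilate_invert, dilate_invert_single]

/-! ### The two-sided sums multiplied by powers of `Θ`. -/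

/-- The series of `Θ² ∑_{m ∈ ℤ} t / (1 - t)²`, where `t = q^m X`. -/
def thetaSqSeries : EntireLaurent k :=
  (1 - single (-1) 1) ^ 2 * (invert (eulerSeries hq 0) ^ 2 * eulerSqSeries hq +
    eulerSeries hq 0 ^ 2 * invert (eulerSqSeries hq)) +
    single (-1) 1 * eulerSeries hq 0 ^ 2 * invert (eulerSeries hq 0) ^ 2

/-- The series of `Θ³ ∑_{m ∈ ℤ} t² / (1 - t)³`, where `t = q^m X`. -/
def thetaCubeSeries : EntireLaurent k :=
  -- For negative `m` put `t = s⁻¹`: then `t² / (1 - t)³ = -s / (1 - s)³`, hence the primed series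
  -- and the minus sign. The term `m = 0` is `(1 - X⁻¹)³ X² / (1 - X)³ = -X⁻¹`.
  (1 - single (-1) 1) ^ 3 * (invert (eulerSeries hq 0) ^ 3 * eulerCubeSeries hq -
    eulerSeries hq 0 ^ 3 * invert (eulerCubeSeries' hq)) -
    single (-1) 1 * eulerSeries hq 0 ^ 3 * invert (eulerSeries hq 0) ^ 3

theorem dilate_single_neg_one : dilate q (single (-1) 1) = single (-1) ((q : k)⁻¹) := by
  rw [dilate_single]; simp

theorem single_mul_single_inv : single 1 (q : k) * single (-1) ((q : k)⁻¹) = 1 := by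
  rw [single_mul_single]; simp [one_def]

/-- Passing to `qX` removes the factor `1 - qX`, and `1 - (qX)⁻¹` takes its place; their quotient is
`-(qX)⁻¹`. -/
theorem dilate_thetaSeries :
    dilate q (thetaSeries hq) = -single (-1) ((q : k)⁻¹) * thetaSeries hq := by
  have h0 := eulerSeries_zero hq
  rw [thetaSeries, map_mul, map_mul, dilate_invert_eulerSeries, map_sub, map_one,
    dilate_single_neg_one]
  generalize invert (eulerSeries hq 0) = t0 at *
  generalize dilate q (eulerSeries hq 0) = s0 at *
  rw [h0]
  linear_combination (-(s0 * (1 - single (-1) 1) * t0)) * (single_mul_single_inv (q := q))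

/-- The two-sided sum is invariant under `X ↦ qX`, so only the automorphy factor of `Θ²` remains.
Formally, one term moves from the positive half to the middle and the middle one to the negative
half. -/
theorem dilate_thetaSqSeries :
    dilate q (thetaSqSeries hq) = (-single (-1) ((q : k)⁻¹)) ^ 2 * thetaSqSeries hq := by
  have h0 := dilate_invert_eulerSeries hq
  have h1 := dilate_invert_eulerSqSeries hq
  have hp := single_mul_single_inv (q := q)
  have h2 := eulerSeries_zero hq
  have h3 := eulerSqSeries_eq hq
  simp only [thetaSqSeries, map_add, map_sub, map_mul, map_pow, map_one, h0, h1,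
    dilate_single_neg_one]
  generalize dilate q (eulerSeries hq 0) = s0 at *
  generalize dilate q (eulerSqSeries hq) = s1 at *
  generalize invert (eulerSeries hq 0) = t0 at *
  generalize invert (eulerSqSeries hq) = t1 at *
  generalize single (-1) ((q : k)⁻¹) = p' at *
  generalize single 1 (q : k) = p at *
  generalize single (-1) (1 : k) = r at *
  have hk : 1 - p' = -(p' * (1 - p)) := by linear_combination (-1 : EntireLaurent k) * hp
  rw [h2, h3, hk]
  linear_combination (-(p' * s0 ^ 2 * (1 - r) ^ 2 * t0 ^ 2)) * hp

theorem dilate_thetaCubeSeries :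
    dilate q (thetaCubeSeries hq) = (-single (-1) ((q : k)⁻¹)) ^ 3 * thetaCubeSeries hq := by
  have h0 := dilate_invert_eulerSeries hq
  have h1 := dilate_invert_eulerCubeSeries' hq
  have hp := single_mul_single_inv (q := q)
  have h2 := eulerSeries_zero hq
  have h3 := eulerCubeSeries_eq hq
  simp only [thetaCubeSeries, map_sub, map_mul, map_pow, map_one, h0, h1,
    dilate_single_neg_one]
  generalize dilate q (eulerSeries hq 0) = s0 at *
  generalize dilate q (eulerCubeSeries hq) = s1 at *
  generalize invert (eulerSeries hq 0) = t0 at *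
  generalize invert (eulerCubeSeries' hq) = t1 at *
  generalize single (-1) ((q : k)⁻¹) = p' at *
  generalize single 1 (q : k) = p at *
  generalize single (-1) (1 : k) = r at *
  have hk : 1 - p' = -(p' * (1 - p)) := by linear_combination (-1 : EntireLaurent k) * hp
  rw [h2, h3, hk]
  linear_combination (p' * s0 ^ 3 * t0 ^ 3 * (1 - r) ^ 3 * (p * p' + 1)) * hp

end ThetaSeries

/-! ### The values of the theta series -/

section Values

open Filter Topology EntireLaurent

/-- The partial sums telescope to `F(u) - F(q^N u)`, which tends to `F(u)`. Summability is automatic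
in the ultrametric setting, since the terms tend to zero. -/
theorem hasSum_of_functional_equation {L : Type*} [NontriviallyNormedField L]
    [IsUltrametricDist L] [CompleteSpace L] {φ F : L → L} {q u : L} (hq : ‖q‖ < 1)
    (hφ : ContinuousAt φ 0) (hφ0 : φ 0 = 0) (hF : ContinuousAt F 0) (hF0 : F 0 = 0)
    (h : ∀ m : ℕ, F (q ^ m * u) = φ (q ^ (m + 1) * u) + F (q ^ (m + 1) * u)) :
    HasSum (fun m : ℕ => φ (q ^ (m + 1) * u)) (F u) := by
  have ht : Tendsto (fun m : ℕ => q ^ m * u) atTop (𝓝 0) := by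
    simpa using (tendsto_pow_atTop_nhds_zero_of_norm_lt_one hq).mul_const u
  have hs : Summable fun m : ℕ => φ (q ^ (m + 1) * u) := by
    refine NonarchimedeanAddGroup.summable_of_tendsto_cofinite_zero ?_
    rw [Nat.cofinite_eq_atTop]
    have := (hφ.tendsto.comp ht).comp (tendsto_add_atTop_nat 1)
    rwa [hφ0] at this
  have hsum : ∀ N, ∑ m ∈ Finset.range N, φ (q ^ (m + 1) * u) = F u - F (q ^ N * u) := by
    intro N
    induction N with
    | zero => simp
    | succ N ih => rw [Finset.sum_range_succ, ih, h N]; ring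
  have hlim : Tendsto (fun N => F u - F (q ^ N * u)) atTop (𝓝 (F u)) := by
    have := (hF.tendsto.comp ht).const_sub (F u)
    rwa [hF0, sub_zero] at this
  have := hs.hasSum.tendsto_sum_nat
  simp only [hsum] at this
  rw [← tendsto_nhds_unique this hlim]
  exact hs.hasSum

variable {k : Type u} [NontriviallyNormedField k]

/-- The power series `eulerSeries` as a function. -/
def eulerFun {L : Type*} [NontriviallyNormedField L] [NormedAlgebra k L] (q : k) (i : ℕ)
    (z : L) : L :=
  ∑' n : ℕ, algebraMap k L ((n.choose i : k) * eulerCoeff q n) * z ^ n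

theorem algebraMap_ne_zero {L : Type*} [NontriviallyNormedField L] [NormedAlgebra k L] (q : kˣ) :
    algebraMap k L q ≠ 0 :=
  (_root_.map_ne_zero _).mpr q.ne_zero

variable [IsUltrametricDist k] [CompleteSpace k] {q : kˣ}
variable {L : Type*} [NontriviallyNormedField L] [NormedAlgebra k L]

theorem norm_algebraMap_lt_one (hq : ‖(q : k)‖ < 1) : ‖algebraMap k L q‖ < 1 := by
  rwa [norm_algebraMap']

theorem eulerFun_zero_right (i : ℕ) : eulerFun (q : k) i (0 : L) = if i = 0 then 1 else 0 := by
  rw [eulerFun, tsum_eq_single 0]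
  · rcases i with _ | i <;> simp [eulerCoeff]
  · intro n hn; simp [hn]

variable [CompleteSpace L]

theorem eval_eulerSeries (hq : ‖(q : k)‖ < 1) (i : ℕ) (u : Lˣ) :
    eval u (eulerSeries hq i) = eulerFun (q : k) i (u : L) :=
  eval_ofPowerSeries _ _ u

theorem analyticAt_eulerFun (hq : ‖(q : k)‖ < 1) (i : ℕ) (z : L) :
    AnalyticAt L (eulerFun (q : k) i) z := by
  let p := FormalMultilinearSeries.ofScalars L
    fun n : ℕ => algebraMap k L ((n.choose i : k) * eulerCoeff (q : k) n)
  have hp : p.radius = ⊤ := by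
    refine p.radius_eq_top_of_summable_norm fun r => ?_
    -- Summability is known for positive radii only and `r` may be zero, hence the comparison with
    -- `r + 1`.
    refine Summable.of_nonneg_of_le (fun n => by positivity) (fun n => ?_)
      (summable_choose_mul_eulerCoeff hq i (r + 1) (by positivity))
    rw [FormalMultilinearSeries.ofScalars_norm, norm_algebraMap']
    gcongr
    simp
  have h := p.hasFPowerSeriesOnBall (by simp [hp])
  have hs : p.sum = eulerFun (q : k) i := by
    ext z
    exact (FormalMultilinearSeries.ofScalars_sum_eq _ z).trans
      (tsum_congr fun n => by rw [smul_eq_mul])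
  rw [hs] at h
  exact h.analyticAt_of_mem (by simp [hp])

theorem eulerFun_eq (hq : ‖(q : k)‖ < 1) (z : L) :
    eulerFun (q : k) 0 z =
      (1 - algebraMap k L q * z) * eulerFun (q : k) 0 (algebraMap k L q * z) := by
  rcases eq_or_ne z 0 with rfl | hz
  · simp
  have h := congrArg (eval (Units.mk0 z hz)) (eulerSeries_zero hq)
  simpa [eval_dilate, eval_eulerSeries, eval_single] using h

theorem eulerFun_pow (hq : ‖(q : k)‖ < 1) (z : L) (N : ℕ) :
    eulerFun (q : k) 0 z = (∏ m ∈ Finset.range N, (1 - algebraMap k L q ^ (m + 1) * z)) *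
      eulerFun (q : k) 0 (algebraMap k L q ^ N * z) := by
  induction N with
  | zero => simp
  | succ N ih =>
    rw [ih, eulerFun_eq hq, Finset.prod_range_succ, pow_succ]
    ring_nf

theorem tendsto_eulerFun_pow (hq : ‖(q : k)‖ < 1) (z : L) :
    Tendsto (fun N : ℕ => eulerFun (q : k) 0 (algebraMap k L q ^ N * z)) atTop (𝓝 1) := by
  have ht : Tendsto (fun m : ℕ => algebraMap k L q ^ m * z) atTop (𝓝 0) := by
    simpa using (tendsto_pow_atTop_nhds_zero_of_norm_lt_one
      (norm_algebraMap_lt_one (L := L) hq)).mul_const z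
  have := (analyticAt_eulerFun hq 0 (0 : L)).continuousAt.tendsto.comp ht
  rwa [eulerFun_zero_right, if_pos rfl] at this

/-- Since `e(q^N z)` tends to `e(0) = 1`, splitting off finitely many nonzero factors leaves a
nonzero value. -/
theorem eulerFun_ne_zero (hq : ‖(q : k)‖ < 1) {z : L}
    (hz : ∀ m : ℕ, 1 - algebraMap k L q ^ (m + 1) * z ≠ 0) : eulerFun (q : k) 0 z ≠ 0 := by
  obtain ⟨N, hN⟩ := ((tendsto_eulerFun_pow hq z).eventually_ne one_ne_zero).exists
  rw [eulerFun_pow hq z N]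
  exact mul_ne_zero (Finset.prod_ne_zero_iff.mpr fun m _ => hz m) hN

theorem hasProd_eulerFun (hq : ‖(q : k)‖ < 1) (z : L) :
    HasProd (fun m : ℕ => 1 - algebraMap k L q ^ (m + 1) * z) (eulerFun (q : k) 0 z) := by
  have hm : Multipliable fun m : ℕ => 1 - algebraMap k L q ^ (m + 1) * z := by
    simp only [sub_eq_add_neg]
    refine multipliable_one_add_of_summable ?_
    simp only [norm_neg, norm_mul, norm_pow]
    exact ((summable_nat_add_iff 1).mpr (summable_geometric_of_lt_one (norm_nonneg _)
      (norm_algebraMap_lt_one hq))).mul_right _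
  have h1 := hm.hasProd.tendsto_prod_nat.mul (tendsto_eulerFun_pow hq z)
  simp only [← eulerFun_pow hq z, mul_one] at h1
  rw [tendsto_nhds_unique tendsto_const_nhds h1]
  exact hm.hasProd

theorem Theta_eq (hq : ‖(q : k)‖ < 1) (z : L) : Theta (algebraMap k L q) z =
    (1 - z⁻¹) * eulerFun (q : k) 0 z * eulerFun (q : k) 0 z⁻¹ := by
  rw [Theta, ((hasProd_eulerFun hq z).mul (hasProd_eulerFun hq z⁻¹)).tprod_eq, mul_assoc]

theorem eval_thetaSeries (hq : ‖(q : k)‖ < 1) (u : Lˣ) :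
    eval u (thetaSeries hq) = Theta (algebraMap k L q) (u : L) := by
  rw [Theta_eq hq, thetaSeries, map_mul, map_mul, eval_invert, eval_eulerSeries, eval_eulerSeries,
    map_sub, map_one, eval_single]
  simp

theorem Theta_mul (hq : ‖(q : k)‖ < 1) {z : L} (hz : z ≠ 0) :
    Theta (algebraMap k L q) (algebraMap k L q * z) =
      -((algebraMap k L q)⁻¹ * z⁻¹ * Theta (algebraMap k L q) z) := by
  have h := congrArg (eval (Units.mk0 z hz)) (dilate_thetaSeries hq)
  simpa [eval_dilate, eval_thetaSeries, eval_single] using h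

theorem exists_Theta_zpow_mul (hq : ‖(q : k)‖ < 1) (m : ℤ) : ∃ κ : L, κ ≠ 0 ∧ ∀ z : L, z ≠ 0 →
    Theta (algebraMap k L q) (algebraMap k L q ^ m * z) =
      κ * z ^ (-m) * Theta (algebraMap k L q) z := by
  have hq0 : algebraMap k L q ≠ 0 := algebraMap_ne_zero q
  induction m with
  | zero => exact ⟨1, one_ne_zero, by simp⟩
  | succ m ih =>
    obtain ⟨κ, hκ, h⟩ := ih
    refine ⟨-((algebraMap k L q)⁻¹ * ((algebraMap k L q) ^ (m : ℤ))⁻¹ * κ),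
      by simp [hκ, hq0], fun z hz => ?_⟩
    rw [zpow_add_one₀ hq0, mul_comm (_ ^ _) (algebraMap k L q), mul_assoc,
      Theta_mul hq (mul_ne_zero (zpow_ne_zero _ hq0) hz), h z hz, neg_add, zpow_add₀ hz, zpow_neg_one,
      mul_inv]
    ring
  | pred m ih =>
    obtain ⟨κ, hκ, h⟩ := ih
    refine ⟨-(algebraMap k L q ^ (-(m : ℤ)) * κ), by simp [hκ, hq0], fun z hz => ?_⟩
    have h1 := Theta_mul hq (mul_ne_zero (zpow_ne_zero (-(m : ℤ) - 1) hq0) hz)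
    rw [← mul_assoc, ← zpow_one_add₀ hq0, add_sub_cancel, h z hz, mul_inv, zpow_sub_one₀ hq0,
      mul_inv, inv_inv] at h1
    rw [zpow_sub_one₀ hq0, neg_sub, sub_neg_eq_add, add_comm, zpow_add_one₀ hz]
    have hz' : z ^ (-(-(m : ℤ))) = z ^ (m : ℤ) := by simp
    rw [hz'] at h1
    have hqm : (algebraMap k L q ^ (-(m : ℤ)))⁻¹ ≠ 0 := by simp [hq0]
    field_simp at h1 ⊢
    linear_combination h1

end Values

/-! ### Theta functions and the coordinates of the Tate curve -/

section Coordinates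

open Filter Topology EntireLaurent

/-- The constant `∑_{m ≥ 1} m q^m / (1 - q^m)`. -/
def tateConst {k : Type*} [NontriviallyNormedField k] (q : k) : k :=
  ∑' m : ℕ, ((m + 1 : ℕ) : k) * (q ^ (m + 1) / (1 - q ^ (m + 1)))

variable {k : Type u} [NontriviallyNormedField k]
variable [IsUltrametricDist k] [CompleteSpace k] {q : kˣ}
variable {L : Type*} [NontriviallyNormedField L] [NormedAlgebra k L] [CompleteSpace L]

/-- The constant enters the coefficients of the lines, which must lie in `k` and serve all `L` at
once. -/
theorem algebraMap_tateConst (hq : ‖(q : k)‖ < 1) :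
    algebraMap k L (tateConst (q : k)) = tateConst (algebraMap k L q) := by
  have hs : Summable fun m : ℕ =>
      ((m + 1 : ℕ) : k) * ((q : k) ^ (m + 1) / (1 - (q : k) ^ (m + 1))) := by
    refine NonarchimedeanAddGroup.summable_of_tendsto_cofinite_zero ?_
    rw [Nat.cofinite_eq_atTop]
    have hqn : Tendsto (fun n : ℕ => (q : k) ^ (n + 1)) atTop (𝓝 0) :=
      (tendsto_pow_atTop_nhds_zero_of_norm_lt_one hq).comp (tendsto_add_atTop_nat 1)
    have h1 := hqn.div (hqn.const_sub 1) (by simp)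
    rw [zero_div] at h1
    refine squeeze_zero_norm (fun m => ?_) (tendsto_zero_iff_norm_tendsto_zero.mp h1)
    rw [norm_mul]
    exact mul_le_of_le_one_left (norm_nonneg _) (IsUltrametricDist.norm_natCast_le_one k _)
  exact (hs.hasSum.mapL (algebraMapCLM k L)).tsum_eq.symm.trans (tsum_congr fun m => by simp)

theorem one_sub_pow_mul_ne_zero {u : L} (hu : ∀ m : ℤ, u ≠ algebraMap k L q ^ m) (m : ℕ) :
    1 - algebraMap k L q ^ (m + 1) * u ≠ 0 := by
  intro h
  refine hu (-((m + 1 : ℕ) : ℤ)) ?_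
  rw [zpow_neg, zpow_natCast]
  exact eq_inv_of_mul_eq_one_right (sub_eq_zero.mp h).symm

theorem inv_ne_zpow {u : L} (hu : ∀ m : ℤ, u ≠ algebraMap k L q ^ m) (m : ℤ) :
    u⁻¹ ≠ algebraMap k L q ^ m := by
  intro h
  refine hu (-m) ?_
  rw [zpow_neg, ← h, inv_inv]

theorem Theta_ne_zero (hq : ‖(q : k)‖ < 1) {u : L} (hu : ∀ m : ℤ, u ≠ algebraMap k L q ^ m) :
    Theta (algebraMap k L q) u ≠ 0 := by
  rw [Theta_eq hq]
  refine mul_ne_zero (mul_ne_zero ?_ (eulerFun_ne_zero hq (one_sub_pow_mul_ne_zero hu)))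
    (eulerFun_ne_zero hq (one_sub_pow_mul_ne_zero (inv_ne_zpow hu)))
  intro h
  exact inv_ne_zpow hu 0 (by simpa using (sub_eq_zero.mp h).symm)

theorem Theta_one {K : Type*} [NontriviallyNormedField K] (q : K) : Theta q 1 = 0 := by
  simp [Theta]

theorem eulerFun_one_ne_zero (hq : ‖(q : k)‖ < 1) : eulerFun (q : k) 0 (1 : L) ≠ 0 :=
  eulerFun_ne_zero hq fun m => by
    rw [mul_one]; exact one_sub_pow_ne_zero (norm_algebraMap_lt_one hq) m

theorem analyticAt_Theta (hq : ‖(q : k)‖ < 1) {z : L} (hz : z ≠ 0) :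
    AnalyticAt L (Theta (algebraMap k L q)) z := by
  have h : Theta (algebraMap k L q) = fun z : L =>
      (1 - z⁻¹) * eulerFun (q : k) 0 z * eulerFun (q : k) 0 z⁻¹ := funext (Theta_eq hq)
  rw [h]
  have hi : AnalyticAt L (fun z : L => z⁻¹) z := analyticAt_id.fun_inv hz
  exact ((analyticAt_const.sub hi).mul (analyticAt_eulerFun hq 0 z)).mul
    ((analyticAt_eulerFun hq 0 z⁻¹).fun_comp hi)

open Classical in
/-- The order at `α` of the theta function with zeroes at `c q^m` for `m ∈ ℤ`. -/
def thetaOrder {K : Type*} [NontriviallyNormedField K] (q c α : K) : ℕ :=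
  if ∃ m : ℤ, α = c * q ^ m then 1 else 0

/-- Quasi-periodicity moves a zero `α = c q^m` to `1`, where the factor `1 - (α⁻¹z)⁻¹ = (z - α) z⁻¹`
shows that it is simple. -/
theorem exists_Theta_eq_pow_mul (hq : ‖(q : k)‖ < 1) {c α : L} (hc : c ≠ 0) (hα : α ≠ 0) :
    ∃ g : L → L, AnalyticAt L g α ∧ g α ≠ 0 ∧ ∀ᶠ z in 𝓝 α, Theta (algebraMap k L q) (c⁻¹ * z) =
      (z - α) ^ thetaOrder (algebraMap k L q) c α * g z := by
  unfold thetaOrder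
  split_ifs with h
  · obtain ⟨m, hm⟩ := h
    obtain ⟨κ, hκ, hΘ⟩ := exists_Theta_zpow_mul (L := L) hq m
    refine ⟨fun z => κ * (α⁻¹ * z) ^ (-m) * (z⁻¹ * eulerFun (q : k) 0 (α⁻¹ * z) *
      eulerFun (q : k) 0 (α⁻¹ * z)⁻¹), ?_, ?_, ?_⟩
    · have h1 : AnalyticAt L (fun z : L => α⁻¹ * z) α := analyticAt_const.mul analyticAt_id
      have h2 : α⁻¹ * α ≠ 0 := by simp [hα]
      exact (analyticAt_const.mul (h1.fun_zpow h2)).mul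
        (((analyticAt_id.fun_inv hα).mul ((analyticAt_eulerFun hq 0 _).fun_comp h1)).mul
          ((analyticAt_eulerFun hq 0 _).fun_comp (h1.fun_inv h2)))
    · simp [hα, hκ, eulerFun_one_ne_zero hq]
    · filter_upwards [eventually_ne_nhds hα] with z hz
      have hz' : c⁻¹ * z = algebraMap k L q ^ m * (α⁻¹ * z) := by
        have : algebraMap k L q ^ m ≠ 0 := zpow_ne_zero _ (algebraMap_ne_zero q)
        rw [hm]; field_simp
      rw [hz', hΘ _ (by simp [hα, hz]), Theta_eq hq]
      field_simp
  · refine ⟨fun z => Theta (algebraMap k L q) (c⁻¹ * z), ?_, ?_, by simp⟩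
    · exact (analyticAt_Theta hq (by simp [hc, hα])).fun_comp (analyticAt_const.mul analyticAt_id)
    · refine Theta_ne_zero hq fun m hm => h ⟨m, ?_⟩
      rw [← hm]; field_simp

/-- The function of the series `eulerSqSeries`. -/
def eulerSqFun (q : k) (z : L) : L :=
  -eulerFun q 0 z * eulerFun q 1 z + eulerFun q 1 z ^ 2 - 2 * (eulerFun q 0 z * eulerFun q 2 z)

/-- The function of the series `eulerCubeSeries`. -/
def eulerCubeFun (q : k) (z : L) : L :=
  eulerFun q 0 z * eulerFun q 1 z ^ 2 - 2 * (eulerFun q 0 z ^ 2 * eulerFun q 2 z) -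
    eulerFun q 1 z ^ 3 + 3 * (eulerFun q 0 z * eulerFun q 1 z * eulerFun q 2 z) -
    3 * (eulerFun q 0 z ^ 2 * eulerFun q 3 z)

/-- The function of the series `eulerCubeSeries'`. -/
def eulerCubeFun' (q : k) (z : L) : L :=
  eulerCubeFun q z + eulerFun q 0 z * eulerSqFun q z

theorem eval_eulerSqSeries (hq : ‖(q : k)‖ < 1) (u : Lˣ) :
    eval u (eulerSqSeries hq) = eulerSqFun (q : k) (u : L) := by
  simp only [eulerSqSeries, eulerSqFun, map_add, map_sub, map_neg, map_mul, map_pow, map_ofNat,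
    eval_eulerSeries]

theorem eval_eulerCubeSeries (hq : ‖(q : k)‖ < 1) (u : Lˣ) :
    eval u (eulerCubeSeries hq) = eulerCubeFun (q : k) (u : L) := by
  simp only [eulerCubeSeries, eulerCubeFun, map_add, map_sub, map_mul, map_pow, map_ofNat,
    eval_eulerSeries]

theorem eval_eulerCubeSeries' (hq : ‖(q : k)‖ < 1) (u : Lˣ) :
    eval u (eulerCubeSeries' hq) = eulerCubeFun' (q : k) (u : L) := by
  rw [eulerCubeSeries', eulerCubeFun', map_add, map_mul, eval_eulerSeries, eval_eulerSqSeries,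
    eval_eulerCubeSeries]

theorem continuous_eulerFun (hq : ‖(q : k)‖ < 1) (i : ℕ) :
    Continuous (eulerFun (L := L) (q : k) i) :=
  continuous_iff_continuousAt.mpr fun z => (analyticAt_eulerFun hq i z).continuousAt

theorem continuous_eulerSqFun (hq : ‖(q : k)‖ < 1) : Continuous (eulerSqFun (L := L) (q : k)) := by
  have := continuous_eulerFun (L := L) hq
  unfold eulerSqFun
  fun_prop

theorem continuous_eulerCubeFun (hq : ‖(q : k)‖ < 1) :
    Continuous (eulerCubeFun (L := L) (q : k)) := by
  have := continuous_eulerFun (L := L) hq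
  unfold eulerCubeFun
  fun_prop

theorem continuous_eulerCubeFun' (hq : ‖(q : k)‖ < 1) :
    Continuous (eulerCubeFun' (L := L) (q : k)) :=
  (continuous_eulerCubeFun hq).add ((continuous_eulerFun hq 0).mul (continuous_eulerSqFun hq))

theorem eulerSqFun_zero : eulerSqFun (q : k) (0 : L) = 0 := by
  simp [eulerSqFun, eulerFun_zero_right]

theorem eulerCubeFun_zero : eulerCubeFun (q : k) (0 : L) = 0 := by
  simp [eulerCubeFun, eulerFun_zero_right]

theorem eulerCubeFun'_zero : eulerCubeFun' (q : k) (0 : L) = 0 := by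
  simp [eulerCubeFun', eulerCubeFun_zero, eulerSqFun_zero]

theorem eulerSqFun_eq (hq : ‖(q : k)‖ < 1) {z : L} (hz : z ≠ 0) : eulerSqFun (q : k) z =
    algebraMap k L q * z * eulerFun (q : k) 0 (algebraMap k L q * z) ^ 2 +
      (1 - algebraMap k L q * z) ^ 2 * eulerSqFun (q : k) (algebraMap k L q * z) := by
  have h := congrArg (eval (Units.mk0 z hz)) (eulerSqSeries_eq hq)
  simpa [eval_dilate, eval_eulerSeries, eval_eulerSqSeries, eval_single] using h

theorem eulerCubeFun_eq (hq : ‖(q : k)‖ < 1) {z : L} (hz : z ≠ 0) : eulerCubeFun (q : k) z =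
    (algebraMap k L q * z) ^ 2 * eulerFun (q : k) 0 (algebraMap k L q * z) ^ 3 +
      (1 - algebraMap k L q * z) ^ 3 * eulerCubeFun (q : k) (algebraMap k L q * z) := by
  have h := congrArg (eval (Units.mk0 z hz)) (eulerCubeSeries_eq hq)
  simpa [eval_dilate, eval_eulerSeries, eval_eulerCubeSeries, eval_single] using h

theorem eulerCubeFun'_eq (hq : ‖(q : k)‖ < 1) {z : L} (hz : z ≠ 0) : eulerCubeFun' (q : k) z =
    algebraMap k L q * z * eulerFun (q : k) 0 (algebraMap k L q * z) ^ 3 +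
      (1 - algebraMap k L q * z) ^ 3 * eulerCubeFun' (q : k) (algebraMap k L q * z) := by
  have h := congrArg (eval (Units.mk0 z hz)) (eulerCubeSeries'_eq hq)
  simpa [eval_dilate, eval_eulerSeries, eval_eulerCubeSeries', eval_single] using h

variable [IsUltrametricDist L]

/-- If `F(z) = φ(qz) e(qz)^d + (1 - qz)^d F(qz)` then `∑_{m ≥ 1} φ(q^m u) / (1 - q^m u)^d` is
`F(u) / e(u)^d`. -/
theorem hasSum_eulerFun_div (hq : ‖(q : k)‖ < 1) {φ F : L → L} {d : ℕ} (hφ : Continuous φ)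
    (hφ0 : φ 0 = 0) (hF : Continuous F) (hF0 : F 0 = 0)
    (h : ∀ z : L, z ≠ 0 → F z =
      φ (algebraMap k L q * z) * eulerFun (q : k) 0 (algebraMap k L q * z) ^ d +
        (1 - algebraMap k L q * z) ^ d * F (algebraMap k L q * z))
    {u : L} (hu0 : u ≠ 0) (hu : ∀ m : ℤ, u ≠ algebraMap k L q ^ m) :
    HasSum (fun m : ℕ => φ (algebraMap k L q ^ (m + 1) * u) /
      (1 - algebraMap k L q ^ (m + 1) * u) ^ d) (F u / eulerFun (q : k) 0 u ^ d) := by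
  have he : eulerFun (q : k) 0 (0 : L) ^ d ≠ 0 := by simp [eulerFun_zero_right]
  refine hasSum_of_functional_equation (φ := fun z => φ z / (1 - z) ^ d)
    (F := fun z => F z / eulerFun (q : k) 0 z ^ d) (norm_algebraMap_lt_one hq)
    (hφ.continuousAt.div (by fun_prop) (by simp)) (by simp [hφ0])
    (hF.continuousAt.div ((continuous_eulerFun hq 0).pow d).continuousAt he) (by simp [hF0])
    fun m => ?_
  have hz : algebraMap k L q ^ m * u ≠ 0 := mul_ne_zero (pow_ne_zero _ (algebraMap_ne_zero q)) hu0
  have h1 : 1 - algebraMap k L q ^ (m + 1) * u ≠ 0 := one_sub_pow_mul_ne_zero hu m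
  have h2 : eulerFun (q : k) 0 (algebraMap k L q ^ (m + 1) * u) ≠ 0 := by
    refine eulerFun_ne_zero hq fun j => ?_
    have := one_sub_pow_mul_ne_zero hu (j + 1 + m)
    rwa [← mul_assoc, ← pow_add, ← add_assoc (j + 1)]
  have h3 := h _ hz
  have h4 := eulerFun_eq hq (algebraMap k L q ^ m * u)
  rw [← mul_assoc, ← pow_succ'] at h3 h4
  rw [h3, h4]
  generalize 1 - algebraMap k L q ^ (m + 1) * u = t at h1 ⊢
  field_simp
  ring

/-- The sum is split into `m ≥ 1`, `m = 0` and `m < 0`; as `t / (1 - t)²` is invariant under `t ↦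
t⁻¹`, the last part is the first one at `u⁻¹`. -/
theorem tateX_eq (hq : ‖(q : k)‖ < 1) {u : L} (hu0 : u ≠ 0)
    (hu : ∀ m : ℤ, u ≠ algebraMap k L q ^ m) :
    tateX (algebraMap k L q) u + 2 * tateConst (algebraMap k L q) =
      u / (1 - u) ^ 2 + eulerSqFun (q : k) u / eulerFun (q : k) 0 u ^ 2 +
        eulerSqFun (q : k) u⁻¹ / eulerFun (q : k) 0 u⁻¹ ^ 2 := by
  have hq0 : algebraMap k L q ≠ 0 := algebraMap_ne_zero q
  have h1 := hasSum_eulerFun_div hq (φ := fun z => z) continuous_id rfl (continuous_eulerSqFun hq)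
    eulerSqFun_zero (fun z hz => eulerSqFun_eq hq hz) hu0 hu
  have h2 := hasSum_eulerFun_div hq (φ := fun z => z) continuous_id rfl (continuous_eulerSqFun hq)
    eulerSqFun_zero (fun z hz => eulerSqFun_eq hq hz) (inv_ne_zero hu0) (inv_ne_zpow hu)
  have h3 := HasSum.zero_add (f := fun m : ℕ => algebraMap k L q ^ m * u /
    (1 - algebraMap k L q ^ m * u) ^ 2) h1
  rw [pow_zero, one_mul] at h3
  have h4 := HasSum.of_nat_of_neg_add_one (f := fun m : ℤ => algebraMap k L q ^ m * u /
    (1 - algebraMap k L q ^ m * u) ^ 2) (by simpa using h3) (by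
      refine (congrArg (HasSum · _) (funext fun m => ?_)).mpr h2
      have h5 : algebraMap k L q ^ (-((m : ℤ) + 1)) * u = (algebraMap k L q ^ (m + 1) * u⁻¹)⁻¹ := by
        rw [zpow_neg, mul_inv, inv_inv]; norm_cast
      have h6 := one_sub_pow_mul_ne_zero (inv_ne_zpow hu) m
      have h7 : algebraMap k L q ^ (m + 1) * u⁻¹ ≠ 0 := by simp [hq0, hu0]
      rw [h5]
      generalize algebraMap k L q ^ (m + 1) * u⁻¹ = t at h6 h7 ⊢
      have h8 : 1 - t⁻¹ = -((1 - t) * t⁻¹) := by field_simp; ring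
      rw [h8]
      field_simp)
  rw [tateX, h4.tsum_eq, tateConst]
  ring

theorem tateY_eq (hq : ‖(q : k)‖ < 1) {u : L} (hu0 : u ≠ 0)
    (hu : ∀ m : ℤ, u ≠ algebraMap k L q ^ m) :
    tateY (algebraMap k L q) u - tateConst (algebraMap k L q) =
      u ^ 2 / (1 - u) ^ 3 + eulerCubeFun (q : k) u / eulerFun (q : k) 0 u ^ 3 -
        eulerCubeFun' (q : k) u⁻¹ / eulerFun (q : k) 0 u⁻¹ ^ 3 := by
  have hq0 : algebraMap k L q ≠ 0 := algebraMap_ne_zero q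
  have h1 := hasSum_eulerFun_div hq (φ := fun z => z ^ 2) (continuous_pow 2) (by simp)
    (continuous_eulerCubeFun hq) eulerCubeFun_zero (fun z hz => eulerCubeFun_eq hq hz) hu0 hu
  have h2 := (hasSum_eulerFun_div hq (φ := fun z => z) continuous_id rfl
    (continuous_eulerCubeFun' hq) eulerCubeFun'_zero (fun z hz => eulerCubeFun'_eq hq hz)
    (inv_ne_zero hu0) (inv_ne_zpow hu)).neg
  have h3 := HasSum.zero_add (f := fun m : ℕ => (algebraMap k L q ^ m * u) ^ 2 /
    (1 - algebraMap k L q ^ m * u) ^ 3) h1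
  rw [pow_zero, one_mul] at h3
  have h4 := HasSum.of_nat_of_neg_add_one (f := fun m : ℤ => (algebraMap k L q ^ m * u) ^ 2 /
    (1 - algebraMap k L q ^ m * u) ^ 3) (by simpa using h3) (by
      refine (congrArg (HasSum · _) (funext fun m => ?_)).mpr h2
      have h5 : algebraMap k L q ^ (-((m : ℤ) + 1)) * u = (algebraMap k L q ^ (m + 1) * u⁻¹)⁻¹ := by
        rw [zpow_neg, mul_inv, inv_inv]; norm_cast
      have h6 := one_sub_pow_mul_ne_zero (inv_ne_zpow hu) m
      have h7 : algebraMap k L q ^ (m + 1) * u⁻¹ ≠ 0 := by simp [hq0, hu0]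
      rw [h5]
      generalize algebraMap k L q ^ (m + 1) * u⁻¹ = t at h6 h7 ⊢
      have h8 : 1 - t⁻¹ = -((1 - t) * t⁻¹) := by field_simp; ring
      rw [h8]
      field_simp)
  rw [tateY, h4.tsum_eq, tateConst]
  ring

theorem eval_thetaSqSeries (hq : ‖(q : k)‖ < 1) (u : Lˣ)
    (hu : ∀ m : ℤ, (u : L) ≠ algebraMap k L q ^ m) :
    eval u (thetaSqSeries hq) = Theta (algebraMap k L q) (u : L) ^ 2 *
      (tateX (algebraMap k L q) (u : L) + 2 * tateConst (algebraMap k L q)) := by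
  have h1 := eulerFun_ne_zero hq (one_sub_pow_mul_ne_zero hu)
  have h2 := eulerFun_ne_zero hq (one_sub_pow_mul_ne_zero (inv_ne_zpow hu))
  have h3 : 1 - (u : L) ≠ 0 := fun h => hu 0 (by simpa using (sub_eq_zero.mp h).symm)
  have h4 := u.ne_zero
  rw [tateX_eq hq u.ne_zero hu, Theta_eq hq, thetaSqSeries]
  simp only [map_add, map_sub, map_mul, map_pow, map_one, eval_invert, eval_single,
    eval_eulerSqSeries, eval_eulerSeries, Units.val_inv_eq_inv_val, zpow_neg_one, one_mul]
  generalize eulerFun (q : k) 0 (u : L)⁻¹ = t at *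
  field_simp
  ring

theorem eval_thetaCubeSeries (hq : ‖(q : k)‖ < 1) (u : Lˣ)
    (hu : ∀ m : ℤ, (u : L) ≠ algebraMap k L q ^ m) :
    eval u (thetaCubeSeries hq) = Theta (algebraMap k L q) (u : L) ^ 3 *
      (tateY (algebraMap k L q) (u : L) - tateConst (algebraMap k L q)) := by
  have h1 := eulerFun_ne_zero hq (one_sub_pow_mul_ne_zero hu)
  have h2 := eulerFun_ne_zero hq (one_sub_pow_mul_ne_zero (inv_ne_zpow hu))
  have h3 : 1 - (u : L) ≠ 0 := fun h => hu 0 (by simpa using (sub_eq_zero.mp h).symm)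
  have h4 := u.ne_zero
  rw [tateY_eq hq u.ne_zero hu, Theta_eq hq, thetaCubeSeries]
  simp only [map_sub, map_mul, map_pow, map_one, eval_invert, eval_single,
    eval_eulerCubeSeries, eval_eulerCubeSeries', eval_eulerSeries, Units.val_inv_eq_inv_val,
    zpow_neg_one, one_mul]
  generalize eulerFun (q : k) 0 (u : L)⁻¹ = t at *
  field_simp
  ring

end Coordinates

/-! ### Quotients of theta functions as rational functions on the Tate curve -/

section RationalFunctions

open Filter Topology EntireLaurent

variable {k : Type u} [NontriviallyNormedField k]

section EvalAt

variable (L : Type u) [NontriviallyNormedField L] [NormedAlgebra k L] (x y : L)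

theorem evalAt_mul (P Q : k[X][Y]) : evalAt L x y (P * Q) = evalAt L x y P * evalAt L x y Q := by
  simp [evalAt, evalEval]

theorem evalAt_linear (a b c : k) :
    evalAt L x y (Polynomial.C (Polynomial.C a + Polynomial.C b * Polynomial.X) +
      Polynomial.C (Polynomial.C c) * Polynomial.X) =
      algebraMap k L a + algebraMap k L b * x + algebraMap k L c * y := by
  simp [evalAt, evalEval]

end EvalAt

/-- Holds on every Weierstrass curve, because `1, Y` is a basis of the coordinate ring over `k[X]`.
-/
theorem mk_linear_ne_zero (W : WeierstrassCurve.Affine k) {a b c : k}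
    (h : ¬ (a = 0 ∧ b = 0 ∧ c = 0)) :
    WeierstrassCurve.Affine.CoordinateRing.mk W
      (Polynomial.C (Polynomial.C a + Polynomial.C b * Polynomial.X) +
        Polynomial.C (Polynomial.C c) * Polynomial.X) ≠ 0 := by
  intro h0
  have h1 := WeierstrassCurve.Affine.CoordinateRing.smul_basis_eq_zero (W' := W)
    (p := Polynomial.C a + Polynomial.C b * Polynomial.X) (q := Polynomial.C c) (by
      rw [WeierstrassCurve.Affine.CoordinateRing.smul,
        WeierstrassCurve.Affine.CoordinateRing.smul, mul_one, ← map_mul, ← map_add]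
      exact h0)
  refine h ⟨?_, ?_, Polynomial.C_eq_zero.mp h1.2⟩
  · simpa using congrArg (fun p => Polynomial.coeff p 0) h1.1
  · simpa using congrArg (fun p => Polynomial.coeff p 1) h1.1

variable [IsUltrametricDist k] [CompleteSpace k] {q : kˣ} (hq : ‖(q : k)‖ < 1)

theorem neg_single (n : ℤ) (c : k) : -single n c = single n (-c) := by
  ext m
  rw [EntireLaurent.coeff_neg, coeff_single, coeff_single]
  split_ifs <;> simp

theorem eventually_Theta_ne_zero {L : Type*} [NontriviallyNormedField L] [NormedAlgebra k L]
    [CompleteSpace L] (hq : ‖(q : k)‖ < 1) {c α : L} (hc : c ≠ 0) (hα : α ≠ 0) :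
    ∀ᶠ z in 𝓝[≠] α, Theta (algebraMap k L q) (c⁻¹ * z) ≠ 0 := by
  obtain ⟨g, hg, hg0, h⟩ := exists_Theta_eq_pow_mul hq hc hα
  filter_upwards [h.filter_mono nhdsWithin_le_nhds,
    (hg.continuousAt.eventually_ne hg0).filter_mono nhdsWithin_le_nhds, self_mem_nhdsWithin]
    with z h1 h2 h3
  rw [h1]
  exact mul_ne_zero (pow_ne_zero _ (sub_ne_zero.mpr h3)) h2

/-! ### Theta functions of degree three. -/

theorem dilate_dilate_thetaSeries (c : kˣ) : dilate q (dilate c (thetaSeries hq)) =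
    single (-1) (-((q : k)⁻¹ * (c : k)⁻¹)) * dilate c (thetaSeries hq) := by
  rw [dilate_dilate, mul_comm, ← dilate_dilate, dilate_thetaSeries, map_mul, neg_single,
    dilate_single]
  congr 2
  rw [zpow_neg_one]; ring

theorem mul_dilate_thetaSeries_mem (c₁ c₂ c₃ : kˣ) (hc : c₁ * c₂ * c₃ = 1) :
    dilate c₁ (thetaSeries hq) * dilate c₂ (thetaSeries hq) * dilate c₃ (thetaSeries hq) ∈
      quasiPeriodic q 3 (-((q : k)⁻¹ ^ 3)) := by
  change dilate q _ = single (-3) _ * _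
  have h : -((q : k)⁻¹ ^ 3) = -((q : k)⁻¹ * (c₁ : k)⁻¹) * -((q : k)⁻¹ * (c₂ : k)⁻¹) *
      -((q : k)⁻¹ * (c₃ : k)⁻¹) := by
    have hc' : (c₁ : k) * c₂ * c₃ = 1 := by simpa using congrArg Units.val hc
    have hc'' : (c₁ : k)⁻¹ * (c₂ : k)⁻¹ * (c₃ : k)⁻¹ = 1 := by rw [← mul_inv, ← mul_inv, hc', inv_one]
    linear_combination (-((q : k)⁻¹ ^ 3)) * (-1 : k) * hc''
  rw [map_mul, map_mul, dilate_dilate_thetaSeries, dilate_dilate_thetaSeries,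
    dilate_dilate_thetaSeries, h, show (-3 : ℤ) = -1 + -1 + -1 by norm_num, ← single_mul_single,
    ← single_mul_single]
  ring

theorem neg_single_pow_three :
    (-single (-1) ((q : k)⁻¹)) ^ 3 = single (-3) (-((q : k)⁻¹ ^ 3)) := by
  rw [neg_single, pow_succ, pow_two, single_mul_single, single_mul_single]
  congr 1
  ring

/-- A basis of the space of theta functions of degree `3`. -/
def thetaBasis : Fin 3 → EntireLaurent k :=
  ![thetaSeries hq ^ 3, thetaSeries hq * thetaSqSeries hq, thetaCubeSeries hq]

theorem thetaBasis_mem (i : Fin 3) : thetaBasis hq i ∈ quasiPeriodic q 3 (-((q : k)⁻¹ ^ 3)) := by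
  change dilate q _ = single (-3) _ * _
  rw [← neg_single_pow_three]
  fin_cases i
  · simp only [thetaBasis, Fin.zero_eta, Matrix.cons_val_zero, map_pow, dilate_thetaSeries]
    ring
  · simp only [thetaBasis, Fin.mk_one, Matrix.cons_val_one, Matrix.cons_val_zero, map_mul,
      dilate_thetaSeries, dilate_thetaSqSeries]
    ring
  · exact dilate_thetaCubeSeries hq

theorem eval_self_thetaSeries (u : kˣ) : eval u (thetaSeries hq) = Theta (q : k) (u : k) :=
  eval_thetaSeries (L := k) hq u

theorem eventually_Theta_one (hq : ‖(q : k)‖ < 1) : ∀ᶠ z in 𝓝[≠] (1 : k), Theta (q : k) z ≠ 0 := by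
  have := eventually_Theta_ne_zero (L := k) hq one_ne_zero one_ne_zero
  simpa using this

/-- The members vanish at `u = 1` to the orders 3, 1 and 0. Evaluating at `1` kills `t 2`, dividing
by `Θ` and letting `u` tend to `1` kills `t 1`, and a point with `Θ ≠ 0` kills `t 0`. -/
theorem thetaBasis_linearIndependent (t : Fin 3 → k)
    (h : ∑ i, t i • thetaBasis hq i = 0) (i : Fin 3) :
    t i = 0 := by
  have he := eulerFun_one_ne_zero (L := k) hq
  have hev : ∀ u : kˣ, t 0 * Theta (q : k) (u : k) ^ 3 + t 1 * (Theta (q : k) (u : k) *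
      eval u (thetaSqSeries hq)) + t 2 * eval u (thetaCubeSeries hq) = 0 := by
    intro u
    have := congrArg (eval (L := k) u) h
    simpa [Fin.sum_univ_three, thetaBasis, EntireLaurent.eval_smul, eval_self_thetaSeries] using this
  have h2 : t 2 = 0 := by
    have h1 : Theta (q : k) 1 = 0 := Theta_one _
    have := hev 1
    rw [Units.val_one, h1] at this
    simpa [thetaCubeSeries, eval_invert, eval_single, eval_eulerSeries, he] using this
  have h1 : t 1 = 0 := by
    -- The pole-free form of `Θ² (x + 2s)`, continuous at `1`, where the expression through `tateX`
    -- is not available.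
    let T : k → k := fun z => (1 - z⁻¹) ^ 2 * (eulerFun (q : k) 0 z⁻¹ ^ 2 * eulerSqFun (q : k) z +
      eulerFun (q : k) 0 z ^ 2 * eulerSqFun (q : k) z⁻¹) +
      z⁻¹ * eulerFun (q : k) 0 z ^ 2 * eulerFun (q : k) 0 z⁻¹ ^ 2
    have hT : ∀ u : kˣ, eval u (thetaSqSeries hq) = T u := by
      intro u
      simp [T, thetaSqSeries, eval_invert, eval_single, eval_eulerSeries, eval_eulerSqSeries]
    have hinv : ContinuousAt (fun z : k => z⁻¹) 1 := continuousAt_inv₀ one_ne_zero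
    have hTc : ContinuousAt T 1 := by
      have h1 := (continuous_eulerFun (L := k) hq 0).continuousAt (x := 1)
      have h2 := (continuous_eulerSqFun (L := k) hq).continuousAt (x := 1)
      have h3 : ContinuousAt (fun z : k => eulerFun (q : k) 0 z⁻¹) 1 :=
        (continuous_eulerFun (L := k) hq 0).continuousAt.comp hinv
      have h4 : ContinuousAt (fun z : k => eulerSqFun (q : k) z⁻¹) 1 :=
        (continuous_eulerSqFun (L := k) hq).continuousAt.comp hinv
      fun_prop
    have hΘ : ContinuousAt (Theta (q : k)) 1 :=
      (analyticAt_Theta (L := k) hq one_ne_zero).continuousAt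
    have hlim := ((hΘ.pow 2).const_mul (t 0)).add (hTc.const_mul (t 1))
    have hzero : (fun z : k => t 0 * Theta (q : k) z ^ 2 + t 1 * T z) =ᶠ[𝓝[≠] 1] fun _ => 0 := by
      filter_upwards [eventually_Theta_one hq,
        (eventually_ne_nhds one_ne_zero).filter_mono nhdsWithin_le_nhds] with z hz hz0
      have := hev (Units.mk0 z hz0)
      rw [hT, h2, Units.val_mk0] at this
      refine (mul_eq_zero.mp (?_ : Theta (q : k) z * _ = 0)).resolve_left hz
      linear_combination this
    have h0 := tendsto_nhds_unique ((hlim.tendsto.mono_left nhdsWithin_le_nhds).congr' hzero)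
      tendsto_const_nhds
    have h1 : Theta (q : k) 1 = 0 := Theta_one _
    simpa [h1, T, he] using h0
  have h0 : t 0 = 0 := by
    obtain ⟨z, hz, hz0⟩ := ((eventually_Theta_one hq).and
      ((eventually_ne_nhds one_ne_zero).filter_mono nhdsWithin_le_nhds)).exists
    have := hev (Units.mk0 z hz0)
    simpa [h1, h2, hz] using this
  fin_cases i
  · exact h0
  · exact h1
  · exact h2

/-! ### From products of theta functions to polynomials in `x` and `y`. -/

/-- The value of a polynomial at the point of the Tate curve with parameter `u`. -/
def tateEval (q : kˣ) (L : Type u) [NontriviallyNormedField L] [NormedAlgebra k L] (u : L)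
    (P : k[X][Y]) : L :=
  evalAt L (tateX (algebraMap k L q) u) (tateY (algebraMap k L q) u) P

theorem tateEval_mul (L : Type u) [NontriviallyNormedField L] [NormedAlgebra k L] (u : L)
    (P Q : k[X][Y]) : tateEval q L u (P * Q) = tateEval q L u P * tateEval q L u Q :=
  evalAt_mul _ _ _ _ _

theorem exists_mul_Theta_eq (hq : ‖(q : k)‖ < 1) (c₁ c₂ c₃ : kˣ) (hc : c₁ * c₂ * c₃ = 1) : ∃ P : k[X][Y],
    WeierstrassCurve.Affine.CoordinateRing.mk (tateCurve (q : k)) P ≠ 0 ∧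
    ∀ (L : Type u) [NontriviallyNormedField L] [IsUltrametricDist L] [CompleteSpace L]
      [NormedAlgebra k L] (u : L), u ≠ 0 → (∀ m : ℤ, u ≠ algebraMap k L q ^ m) →
      Theta (algebraMap k L q) (algebraMap k L c₁ * u) *
        Theta (algebraMap k L q) (algebraMap k L c₂ * u) *
        Theta (algebraMap k L q) (algebraMap k L c₃ * u) =
      Theta (algebraMap k L q) u ^ 3 * tateEval q L u P := by
  obtain ⟨t, ht⟩ := exists_eq_sum_of_mem_quasiPeriodic three_ne_zero
    (neg_ne_zero.mpr (pow_ne_zero 3 (inv_ne_zero q.ne_zero))) (thetaBasis_mem hq)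
    (thetaBasis_linearIndependent hq) (mul_dilate_thetaSeries_mem hq c₁ c₂ c₃ hc)
  have hev : ∀ (L : Type u) [NontriviallyNormedField L] [CompleteSpace L]
      [NormedAlgebra k L] (u : Lˣ),
      Theta (algebraMap k L q) (algebraMap k L c₁ * u) *
        Theta (algebraMap k L q) (algebraMap k L c₂ * u) *
        Theta (algebraMap k L q) (algebraMap k L c₃ * u) =
      algebraMap k L (t 0) * Theta (algebraMap k L q) (u : L) ^ 3 + algebraMap k L (t 1) *
        (Theta (algebraMap k L q) (u : L) * eval u (thetaSqSeries hq)) +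
        algebraMap k L (t 2) * eval u (thetaCubeSeries hq) := by
    intro L _ _ _ u
    have := congrArg (eval u) ht
    simpa [Fin.sum_univ_three, thetaBasis, EntireLaurent.eval_smul, eval_thetaSeries, eval_dilate] using this
  let s := tateConst (q : k)
  -- Expansion of `t 0 + t 1 (x + 2s) + t 2 (y - s)`. If all coefficients were zero, the product of
  -- three theta functions would vanish identically.
  refine ⟨_, mk_linear_ne_zero _ (a := t 0 + 2 * s * t 1 - s * t 2) (b := t 1) (c := t 2) ?_, ?_⟩
  · rintro ⟨h0, h1, h2⟩
    rw [h1, h2] at h0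
    have h0' : t 0 = 0 := by simpa using h0
    have hc' : ∀ c : kˣ, ∀ᶠ z in 𝓝[≠] (1 : k), Theta (q : k) (c * z) ≠ 0 := by
      intro c
      have := eventually_Theta_ne_zero (L := k) hq (inv_ne_zero c.ne_zero) one_ne_zero
      simpa using this
    obtain ⟨z, ⟨⟨⟨hz1, hz2⟩, hz3⟩, hz0⟩⟩ := ((((hc' c₁).and (hc' c₂)).and (hc' c₃)).and
      ((eventually_ne_nhds one_ne_zero).filter_mono nhdsWithin_le_nhds)).exists
    have := hev k (Units.mk0 z hz0)
    rw [h0', h1, h2] at this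
    simp [hz1, hz2, hz3] at this
  · intro L _ _ _ _ u hu0 hu
    have h := hev L (Units.mk0 u hu0)
    rw [eval_thetaSqSeries hq (Units.mk0 u hu0) hu, eval_thetaCubeSeries hq (Units.mk0 u hu0) hu,
      ← algebraMap_tateConst hq, Units.val_mk0] at h
    rw [h, tateEval, evalAt_linear]
    simp only [map_add, map_sub, map_mul, map_ofNat, s]
    ring

/-- The vertical line through a point and its inverse: the third factor is `Θ(u)`, which is nonzero
off `q^ℤ` and cancels. -/
theorem exists_mul_Theta_inv_eq (hq : ‖(q : k)‖ < 1) (c : kˣ) : ∃ P : k[X][Y],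
    WeierstrassCurve.Affine.CoordinateRing.mk (tateCurve (q : k)) P ≠ 0 ∧
    ∀ (L : Type u) [NontriviallyNormedField L] [IsUltrametricDist L] [CompleteSpace L]
      [NormedAlgebra k L] (u : L), u ≠ 0 → (∀ m : ℤ, u ≠ algebraMap k L q ^ m) →
      Theta (algebraMap k L q) ((algebraMap k L c)⁻¹ * u) *
        Theta (algebraMap k L q) (algebraMap k L c * u) =
      Theta (algebraMap k L q) u ^ 2 * tateEval q L u P := by
  obtain ⟨P, hP, h⟩ := exists_mul_Theta_eq hq c⁻¹ c 1 (by simp)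
  refine ⟨P, hP, fun L _ _ _ _ u hu0 hu => ?_⟩
  have h1 := h L u hu0 hu
  have h2 := Theta_ne_zero hq hu
  rw [Units.val_one, map_one, one_mul, Units.val_inv_eq_inv_val, map_inv₀] at h1
  refine mul_right_cancel₀ h2 ?_
  rw [h1]; ring

/-- Abel's reduction. Writing `b` for the product of the earlier `r_j`, the line through `r_i`, `b`,
`(r_i b)⁻¹` divided by the vertical line through `r_i b` replaces the two zeroes `r_i`, `b` by `r_i
b` and the origin. -/
theorem exists_prod_Theta_eq (hq : ‖(q : k)‖ < 1) {ι : Type*}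
    (s : Finset ι) (r : ι → kˣ) : ∃ P Q : k[X][Y],
    WeierstrassCurve.Affine.CoordinateRing.mk (tateCurve (q : k)) P ≠ 0 ∧
    WeierstrassCurve.Affine.CoordinateRing.mk (tateCurve (q : k)) Q ≠ 0 ∧
    ∀ (L : Type u) [NontriviallyNormedField L] [IsUltrametricDist L] [CompleteSpace L]
      [NormedAlgebra k L] (u : L), u ≠ 0 → (∀ m : ℤ, u ≠ algebraMap k L q ^ m) →
      (∏ i ∈ s, Theta (algebraMap k L q) ((algebraMap k L (r i))⁻¹ * u)) *
        Theta (algebraMap k L q) u * tateEval q L u Q =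
      Theta (algebraMap k L q) ((algebraMap k L ↑(∏ i ∈ s, r i))⁻¹ * u) *
        Theta (algebraMap k L q) u ^ s.card * tateEval q L u P := by
  classical
  induction s using Finset.induction_on with
  | empty => exact ⟨1, 1, by simp, by simp, fun L _ _ _ _ u hu0 hu => by simp⟩
  | insert i s hi ih =>
    obtain ⟨P, Q, hP, hQ, h⟩ := ih
    set b := ∏ i ∈ s, r i with hb
    obtain ⟨P', hP', h1⟩ := exists_mul_Theta_eq hq (r i)⁻¹ b⁻¹ (r i * b) (by
      rw [← mul_inv, inv_mul_cancel])
    obtain ⟨Q', hQ', h2⟩ := exists_mul_Theta_inv_eq hq (r i * b)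
    -- The two lines share the factor `Θ(r_i b u)`, which may vanish. The additional `Q'` on both
    -- sides lets `e3` follow without dividing by it.
    refine ⟨P * (P' * Q'), Q * (Q' * Q'), ?_, ?_, fun L _ _ _ _ u hu0 hu => ?_⟩
    · rw [map_mul, map_mul]; exact mul_ne_zero hP (mul_ne_zero hP' hQ')
    · rw [map_mul, map_mul]; exact mul_ne_zero hQ (mul_ne_zero hQ' hQ')
    have e := h L u hu0 hu
    have e1 := h1 L u hu0 hu
    have e2 := h2 L u hu0 hu
    have e0 := Theta_ne_zero hq hu
    rw [Units.val_inv_eq_inv_val, Units.val_inv_eq_inv_val, map_inv₀, map_inv₀] at e1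
    rw [Finset.prod_insert hi, Finset.prod_insert hi, Finset.card_insert_of_notMem hi, ← hb,
      tateEval_mul, tateEval_mul, tateEval_mul, tateEval_mul]
    generalize tateEval q L u P = vP at *
    generalize tateEval q L u Q = vQ at *
    generalize tateEval q L u P' = vP' at *
    generalize tateEval q L u Q' = vQ' at *
    generalize Theta (algebraMap k L q) u = θ at *
    generalize Theta (algebraMap k L q) ((algebraMap k L ↑(r i * b))⁻¹ * u) = θab at *
    generalize Theta (algebraMap k L q) ((algebraMap k L ↑(r i * b)) * u) = θab' at *
    generalize Theta (algebraMap k L q) ((algebraMap k L ↑(r i))⁻¹ * u) = θa at *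
    generalize Theta (algebraMap k L q) ((algebraMap k L ↑b)⁻¹ * u) = θb at *
    generalize ∏ i ∈ s, Theta (algebraMap k L q) ((algebraMap k L (r i))⁻¹ * u) = π at *
    have e3 : θa * θb * (vQ' * vQ') = θab * θ * (vP' * vQ') := by
      refine mul_left_cancel₀ (pow_ne_zero 2 e0) ?_
      linear_combination (-(θa * θb * vQ')) * e2 + θab * vQ' * e1
    linear_combination θa * vQ' * vQ' * e + θ ^ s.card * vP * e3

theorem exists_prod_Theta_eq_prod_Theta (hq : ‖(q : k)‖ < 1) {ι : Type*} [Fintype ι] (r g : ι → kˣ)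
    (hprod : ∏ i, r i = ∏ i, g i) : ∃ P Q : k[X][Y],
    WeierstrassCurve.Affine.CoordinateRing.mk (tateCurve (q : k)) P ≠ 0 ∧
    WeierstrassCurve.Affine.CoordinateRing.mk (tateCurve (q : k)) Q ≠ 0 ∧
    ∀ (L : Type u) [NontriviallyNormedField L] [IsUltrametricDist L] [CompleteSpace L]
      [NormedAlgebra k L] (u : L), u ≠ 0 → (∀ m : ℤ, u ≠ algebraMap k L q ^ m) →
      (∏ i, Theta (algebraMap k L q) ((algebraMap k L (r i))⁻¹ * u)) * tateEval q L u Q =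
      (∏ i, Theta (algebraMap k L q) ((algebraMap k L (g i))⁻¹ * u)) * tateEval q L u P := by
  obtain ⟨P₁, Q₁, hP₁, hQ₁, h₁⟩ := exists_prod_Theta_eq hq Finset.univ r
  obtain ⟨P₂, Q₂, hP₂, hQ₂, h₂⟩ := exists_prod_Theta_eq hq Finset.univ g
  obtain ⟨Z, hZ, h₃⟩ := exists_mul_Theta_inv_eq hq (∏ i, g i)
  -- `Θ(c⁻¹u)`, with `c` the common product, has to be cancelled between the two identities. `Z`
  -- vanishes where it does, so with this factor on both sides the equality holds there as well.
  refine ⟨P₁ * (Q₂ * Z), Q₁ * (P₂ * Z), ?_, ?_, fun L _ _ _ _ u hu0 hu => ?_⟩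
  · rw [map_mul, map_mul]; exact mul_ne_zero hP₁ (mul_ne_zero hQ₂ hZ)
  · rw [map_mul, map_mul]; exact mul_ne_zero hQ₁ (mul_ne_zero hP₂ hZ)
  have e₁ := h₁ L u hu0 hu
  have e₂ := h₂ L u hu0 hu
  have e₃ := h₃ L u hu0 hu
  have e0 := Theta_ne_zero hq hu
  rw [hprod] at e₁
  rw [tateEval_mul, tateEval_mul, tateEval_mul, tateEval_mul]
  generalize tateEval q L u P₁ = vP₁ at *
  generalize tateEval q L u Q₁ = vQ₁ at *
  generalize tateEval q L u P₂ = vP₂ at *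
  generalize tateEval q L u Q₂ = vQ₂ at *
  generalize tateEval q L u Z = vZ at *
  generalize Theta (algebraMap k L q) u = θ at *
  generalize Theta (algebraMap k L q) ((algebraMap k L ↑(∏ i, g i))⁻¹ * u) = θc at *
  generalize ∏ i, Theta (algebraMap k L q) ((algebraMap k L (r i))⁻¹ * u) = πr at *
  generalize ∏ i, Theta (algebraMap k L q) ((algebraMap k L (g i))⁻¹ * u) = πg at *
  rcases eq_or_ne θc 0 with h | h
  · have hz : vZ = 0 := by
      rw [h, zero_mul] at e₃
      exact (mul_eq_zero.mp e₃.symm).resolve_left (pow_ne_zero 2 e0)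
    simp [hz]
  · refine mul_left_cancel₀ (mul_ne_zero (mul_ne_zero h (pow_ne_zero (Fintype.card ι) e0)) e0) ?_
    rw [Finset.card_univ] at e₁ e₂
    linear_combination vZ * θc * θ ^ Fintype.card ι * vP₂ * e₁ -
      vZ * θc * θ ^ Fintype.card ι * vP₁ * e₂

end RationalFunctions

/-! ### The divisor of a quotient of theta functions -/

section Divisor

open Filter Topology

variable {k : Type u} [NontriviallyNormedField k] {q : kˣ}

theorem toE_eq_iff {a b : kˣ} : toE q a = toE q b ↔ ∃ m : ℤ, b = a * q ^ m := by
  refine (QuotientGroup.eq (s := Subgroup.zpowers q)).trans ?_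
  rw [Subgroup.mem_zpowers_iff]
  exact exists_congr fun m => by rw [eq_inv_mul_iff_mul_eq, eq_comm]

theorem toE_surjective : Function.Surjective (toE q) :=
  QuotientGroup.mk'_surjective (Subgroup.zpowers q)

section BaseChange

variable {L : Type u} [NontriviallyNormedField L] [NormedAlgebra k L]

theorem toE_eq_iff_algebraMap {a b : kˣ} : toE q a = toE q b ↔
    ∃ m : ℤ, algebraMap k L b = algebraMap k L a * algebraMap k L q ^ m := by
  rw [toE_eq_iff]
  refine exists_congr fun m => ?_
  rw [← map_zpow₀, ← map_mul, (algebraMap k L).injective.eq_iff, Units.ext_iff]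
  simp

theorem toE_eq_of_eq_mul_zpow {a b : kˣ} {α : L} {m m' : ℤ}
    (ha : α = algebraMap k L a * algebraMap k L q ^ m)
    (hb : α = algebraMap k L b * algebraMap k L q ^ m') : toE q a = toE q b := by
  rw [toE_eq_iff_algebraMap (L := L)]
  have hq0 : algebraMap k L q ≠ 0 := algebraMap_ne_zero q
  refine ⟨m - m', ?_⟩
  rw [zpow_sub₀ hq0, ← mul_div_assoc, ← ha, hb, mul_div_assoc, div_self (zpow_ne_zero _ hq0),
    mul_one]

theorem coeffAt_algebraMap (D : E q → ℤ) (w : kˣ) :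
    coeffAt q L D (algebraMap k L w) = D (toE q w) := by
  have h : ∃ u : kˣ, algebraMap k L u = algebraMap k L w := ⟨w, rfl⟩
  have h1 : h.choose = w := Units.ext ((algebraMap k L).injective h.choose_spec)
  rw [coeffAt, dif_pos h, h1]

theorem coeffAt_of_not_exists (D : E q → ℤ) {α : L} (h : ¬ ∃ u : kˣ, algebraMap k L u = α) :
    coeffAt q L D α = 0 := dif_neg h

theorem coeffAt_neg (D : E q → ℤ) (α : L) : coeffAt q L (-D) α = -coeffAt q L D α := by
  unfold coeffAt
  split_ifs <;> simp

theorem coeffAt_add (D D' : E q → ℤ) (α : L) :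
    coeffAt q L (D + D') α = coeffAt q L D α + coeffAt q L D' α := by
  unfold coeffAt
  split_ifs <;> simp

theorem coeffAt_sumOfPoints_nonneg (S : Set (E q)) (α : L) :
    0 ≤ coeffAt q L (sumOfPoints S) α := by
  unfold coeffAt sumOfPoints
  split_ifs <;> simp

theorem exists_of_thetaOrder_ne_zero {c α : L} (h : thetaOrder (algebraMap k L q) c α ≠ 0) :
    ∃ m : ℤ, α = c * algebraMap k L q ^ m := by
  unfold thetaOrder at h
  by_contra h'
  exact h (if_neg h')

/-- A point of `Lˣ` at which a factor vanishes has the form `r_i q^m`, so it is rational over `k`;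
injectivity on classes lets at most one factor contribute. -/
theorem sum_thetaOrder_eq_coeffAt {n : ℕ} {r : Fin n → kˣ} {S : Set (E q)}
    (hinj : Function.Injective fun i => toE q (r i))
    (hS : Set.range (fun i => toE q (r i)) = S) (α : L) :
    ((∑ i, thetaOrder (algebraMap k L q) (algebraMap k L (r i)) α : ℕ) : ℤ) =
      coeffAt q L (sumOfPoints S) α := by
  classical
  by_cases h : ∃ u : kˣ, algebraMap k L u = α
  · obtain ⟨w, rfl⟩ := h
    rw [coeffAt_algebraMap]
    have h1 : ∀ i, thetaOrder (algebraMap k L q) (algebraMap k L (r i)) (algebraMap k L w) =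
        if toE q (r i) = toE q w then 1 else 0 := by
      intro i
      unfold thetaOrder
      simp only [toE_eq_iff_algebraMap (L := L)]
    simp only [h1, sumOfPoints]
    split_ifs with h2
    · rw [← hS] at h2
      obtain ⟨i, hi⟩ := h2
      rw [Finset.sum_eq_single i]
      · rw [if_pos hi]; rfl
      · intro j _ hj
        exact if_neg fun h => hj (hinj (h.trans hi.symm))
      · simp
    · rw [Finset.sum_eq_zero]
      · rfl
      · intro i _
        exact if_neg fun h => h2 (hS ▸ ⟨i, h⟩)
  · rw [coeffAt_of_not_exists _ h, Finset.sum_eq_zero]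
    · rfl
    · intro i _
      unfold thetaOrder
      refine if_neg ?_
      rintro ⟨m, hm⟩
      exact h ⟨r i * q ^ m, by simp [hm]⟩

end BaseChange

variable [IsUltrametricDist k] [CompleteSpace k]

/-- The function `∏_i Θ_{r_i}(z) / Θ_{g_i}(z)` over an extension field of `k`. -/
def thetaRatio (q : kˣ) (L : Type u) [NontriviallyNormedField L] [NormedAlgebra k L] {n : ℕ}
    (r g : Fin n → kˣ) (z : L) : L :=
  (∏ i, Theta (algebraMap k L q) ((algebraMap k L (r i))⁻¹ * z)) /
    ∏ i, Theta (algebraMap k L q) ((algebraMap k L (g i))⁻¹ * z)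

theorem thetaRatio_self {n : ℕ} (r g : Fin n → kˣ) : thetaRatio q k r g = thetaQuotient q r g := by
  ext z
  simp [thetaRatio, thetaQuotient, ThetaTranslate, Finset.prod_div_distrib]

section Local

variable {L : Type u} [NontriviallyNormedField L] [NormedAlgebra k L] [CompleteSpace L]

theorem exists_prod_Theta_eq_pow_mul (hq : ‖(q : k)‖ < 1) {n : ℕ} (r : Fin n → kˣ) {α : L}
    (hα : α ≠ 0) : ∃ h : L → L, AnalyticAt L h α ∧ h α ≠ 0 ∧ ∀ᶠ z in 𝓝 α,
      ∏ i, Theta (algebraMap k L q) ((algebraMap k L (r i))⁻¹ * z) =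
        (z - α) ^ (∑ i, thetaOrder (algebraMap k L q) (algebraMap k L (r i)) α) * h z := by
  choose h h1 h2 h3 using fun i => exists_Theta_eq_pow_mul hq (algebraMap_ne_zero (L := L) (r i)) hα
  refine ⟨fun z => ∏ i, h i z, Finset.analyticAt_fun_prod _ fun i _ => h1 i,
    Finset.prod_ne_zero_iff.mpr fun i _ => h2 i, ?_⟩
  filter_upwards [eventually_all.mpr h3] with z hz
  rw [Finset.prod_congr rfl fun i _ => hz i, Finset.prod_mul_distrib, Finset.prod_pow_eq_pow_sum]

theorem exists_thetaRatio_eq_zpow_smul (hq : ‖(q : k)‖ < 1) {n : ℕ} {r g : Fin n → kˣ}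
    (hrg : ∀ i j, toE q (r i) ≠ toE q (g j)) {α : L} (hα : α ≠ 0) :
    ∃ h : L → L, AnalyticAt L h α ∧ h α ≠ 0 ∧ ∀ᶠ z in 𝓝 α, thetaRatio q L r g z =
      (z - α) ^ (((∑ i, thetaOrder (algebraMap k L q) (algebraMap k L (r i)) α : ℕ) : ℤ) -
        ((∑ i, thetaOrder (algebraMap k L q) (algebraMap k L (g i)) α : ℕ) : ℤ)) • h z := by
  obtain ⟨h₁, ha₁, hn₁, he₁⟩ := exists_prod_Theta_eq_pow_mul hq r hα
  obtain ⟨h₂, ha₂, hn₂, he₂⟩ := exists_prod_Theta_eq_pow_mul hq g hα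
  -- Needed because the equality is claimed at `z = α` too: with division by zero equal to zero, `0
  -- ^ a / 0 ^ b` agrees with `0 ^ (a - b)` if one exponent is zero, but not always otherwise. This
  -- is what gives the normal form.
  have hzero : (∑ i, thetaOrder (algebraMap k L q) (algebraMap k L (r i)) α) = 0 ∨
      (∑ i, thetaOrder (algebraMap k L q) (algebraMap k L (g i)) α) = 0 := by
    by_contra! hne
    obtain ⟨i, -, hi⟩ := Finset.exists_ne_zero_of_sum_ne_zero hne.1
    obtain ⟨j, -, hj⟩ := Finset.exists_ne_zero_of_sum_ne_zero hne.2
    obtain ⟨m, hm⟩ := exists_of_thetaOrder_ne_zero hi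
    obtain ⟨m', hm'⟩ := exists_of_thetaOrder_ne_zero hj
    exact hrg i j (toE_eq_of_eq_mul_zpow hm hm')
  refine ⟨fun z => h₁ z / h₂ z, ha₁.fun_div ha₂ hn₂, div_ne_zero hn₁ hn₂, ?_⟩
  filter_upwards [he₁, he₂] with z hz₁ hz₂
  rw [thetaRatio, hz₁, hz₂]
  rcases hzero with h | h
  · rw [h, Nat.cast_zero, zero_sub, zpow_neg, zpow_natCast, smul_eq_mul, pow_zero, one_mul,
      div_mul_eq_div_div_swap]
    ring
  · rw [h, Nat.cast_zero, sub_zero, zpow_natCast, smul_eq_mul, pow_zero, one_mul, mul_div_assoc]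

theorem meromorphicNFAt_thetaRatio (hq : ‖(q : k)‖ < 1) {n : ℕ} {r g : Fin n → kˣ}
    (hrg : ∀ i j, toE q (r i) ≠ toE q (g j)) {α : L} (hα : α ≠ 0) :
    MeromorphicNFAt (thetaRatio q L r g) α := by
  obtain ⟨h, ha, hn, he⟩ := exists_thetaRatio_eq_zpow_smul hq hrg hα
  exact Or.inr ⟨_, h, ha, hn, he⟩

theorem meromorphicOrderAt_thetaRatio (hq : ‖(q : k)‖ < 1) {n : ℕ} {r g : Fin n → kˣ}
    {S T : Set (E q)} (hr : Set.range (fun i => toE q (r i)) = S)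
    (hg : Set.range (fun i => toE q (g i)) = T)
    (hri : Function.Injective fun i => toE q (r i)) (hgi : Function.Injective fun i => toE q (g i))
    (hrg : ∀ i j, toE q (r i) ≠ toE q (g j)) {α : L} (hα : α ≠ 0) :
    meromorphicOrderAt (thetaRatio q L r g) α =
      ((coeffAt q L (-sumOfPoints T + sumOfPoints S) α : ℤ) : WithTop ℤ) := by
  obtain ⟨h, ha, hn, he⟩ := exists_thetaRatio_eq_zpow_smul hq hrg hα
  rw [meromorphicOrderAt_eq_int_iff (meromorphicNFAt_thetaRatio hq hrg hα).meromorphicAt,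
    coeffAt_add, coeffAt_neg, ← sum_thetaOrder_eq_coeffAt hri hr, ← sum_thetaOrder_eq_coeffAt hgi hg,
    neg_add_eq_sub]
  exact ⟨h, ha, hn, he.filter_mono nhdsWithin_le_nhds⟩

end Local

theorem exists_isPullback_thetaRatio (hq : ‖(q : k)‖ < 1) {n : ℕ} {r g : Fin n → kˣ}
    (hrg : ∀ i j, toE q (r i) ≠ toE q (g j)) (hprod : ∏ i, r i = ∏ i, g i) :
    ∃ R : RationalFunctions (q : k), R ≠ 0 ∧
      ∀ (L : Type u) [NontriviallyNormedField L] [IsUltrametricDist L] [CompleteSpace L]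
        [NormedAlgebra k L], IsPullback q L R (thetaRatio q L r g) := by
  obtain ⟨P, Q, hP, hQ, h⟩ := exists_prod_Theta_eq_prod_Theta hq r g hprod
  have hinj := IsFractionRing.injective (tateCurve (q : k)).CoordinateRing
    (RationalFunctions (q : k))
  refine ⟨_, div_ne_zero ((map_ne_zero_iff _ hinj).mpr hP) ((map_ne_zero_iff _ hinj).mpr hQ),
    fun L _ _ _ _ => ⟨fun α hα => meromorphicNFAt_thetaRatio hq hrg hα, P, Q, hQ, rfl,
      fun u hu0 hu hev => ?_⟩⟩
  have e := h L u hu0 hu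
  change thetaRatio q L r g u = tateEval q L u P / tateEval q L u Q
  change tateEval q L u Q ≠ 0 at hev
  have hzero : ∀ s : Fin n → kˣ,
      ∏ i, Theta (algebraMap k L q) ((algebraMap k L (s i))⁻¹ * u) = 0 →
      ∃ (i : Fin n) (m : ℤ), u = algebraMap k L (s i) * algebraMap k L q ^ m := by
    intro s hs
    obtain ⟨i, -, hi⟩ := Finset.prod_eq_zero_iff.mp hs
    by_contra! hne
    refine Theta_ne_zero hq (fun m hm => hne i m ?_) hi
    have := algebraMap_ne_zero (L := L) (s i)
    rw [← hm]; field_simp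
  -- A zero of the denominator at which `Q` does not vanish would also be a zero of the numerator,
  -- against the disjointness of the classes.
  by_cases hg : ∏ i, Theta (algebraMap k L q) ((algebraMap k L (g i))⁻¹ * u) = 0
  · rw [hg, zero_mul] at e
    obtain ⟨i, m, hi⟩ := hzero r ((mul_eq_zero.mp e).resolve_right hev)
    obtain ⟨j, m', hj⟩ := hzero g hg
    exact absurd (toE_eq_of_eq_mul_zpow hi hj) (hrg i j)
  · rw [thetaRatio, div_eq_div_iff hg hev, e, mul_comm]

end Divisor

/-! ### Translation by division points -/

section Translation

variable {k : Type u} [NontriviallyNormedField k] [IsUltrametricDist k] [CompleteSpace k] {q : kˣ}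

theorem prod_Theta_mul (hq : ‖(q : k)‖ < 1) {n : ℕ} (r : Fin n → kˣ) (u : kˣ) :
    ∏ i, Theta (q : k) ((r i : k)⁻¹ * (q * u)) =
      (-((q : k)⁻¹ * (u : k)⁻¹)) ^ n * ↑(∏ i, r i) * ∏ i, Theta (q : k) ((r i : k)⁻¹ * u) := by
  have h : ∀ i, Theta (q : k) ((r i : k)⁻¹ * (q * u)) =
      -((q : k)⁻¹ * (u : k)⁻¹) * r i * Theta (q : k) ((r i : k)⁻¹ * u) := by
    intro i
    have := Theta_mul (L := k) hq (z := (r i : k)⁻¹ * u) (by simp)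
    rw [mul_left_comm]
    refine this.trans ?_
    simp only [Algebra.algebraMap_self, RingHom.id_apply, mul_inv, inv_inv]
    ring
  rw [Finset.prod_congr rfl fun i _ => h i, Finset.prod_mul_distrib, Finset.prod_mul_distrib,
    Finset.prod_const, Finset.card_univ, Fintype.card_fin, Units.coe_prod]

theorem thetaQuotient_eq {n : ℕ} (r g : Fin n → kˣ) (z : k) : thetaQuotient q r g z =
    (∏ i, Theta (q : k) ((r i : k)⁻¹ * z)) / ∏ i, Theta (q : k) ((g i : k)⁻¹ * z) :=
  Finset.prod_div_distrib _ _

theorem thetaQuotient_mul (hq : ‖(q : k)‖ < 1) {n : ℕ} {r g : Fin n → kˣ}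
    (hprod : ∏ i, r i = ∏ i, g i) (u : kˣ) :
    thetaQuotient q r g (q * u) = thetaQuotient q r g (u : k) := by
  rw [thetaQuotient_eq, thetaQuotient_eq, prod_Theta_mul hq, prod_Theta_mul hq, hprod]
  exact mul_div_mul_left _ _ (mul_ne_zero (pow_ne_zero _ (by simp)) (Units.ne_zero _))

theorem thetaQuotient_zpow_mul (hq : ‖(q : k)‖ < 1) {n : ℕ} {r g : Fin n → kˣ}
    (hprod : ∏ i, r i = ∏ i, g i) (m : ℤ) (u : kˣ) :
    thetaQuotient q r g ((q ^ m : kˣ) * u) = thetaQuotient q r g (u : k) := by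
  induction m generalizing u with
  | zero => simp
  | succ m ih =>
    have h := ih (q * u)
    rw [Units.val_mul, thetaQuotient_mul hq hprod, ← mul_assoc, ← Units.val_mul,
      ← zpow_add_one] at h
    exact h
  | pred m ih =>
    have h := thetaQuotient_mul hq hprod (q ^ (-(m : ℤ) - 1) * u)
    rw [Units.val_mul, ← mul_assoc, ← Units.val_mul, ← zpow_one_add, add_sub_cancel, ih] at h
    exact h.symm

theorem zpow_sum {α ι : Type*} [CommGroup α] [Fintype ι] (a : α) (m : ι → ℤ) :
    a ^ ∑ i, m i = ∏ i, a ^ m i :=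
  map_sum (zpowersHom α a).toAdditive m Finset.univ

/-- Write `w⁻¹ r_i = r_{π i} q^{m_i}` with a permutation `π`. Each `q^{m_i}` contributes a constant
times `u^{m_i}`, and multiplying over `i` gives `w⁻ⁿ = q^N` with `N = ∑ m_i`. So `N` depends on `w`
and `n` alone and is the same for the `r_i` and the `g_i`. -/
theorem exists_prod_Theta_translate (hq : ‖(q : k)‖ < 1) {n : ℕ} {r : Fin n → kˣ} {w : kˣ}
    (hri : Function.Injective fun i => toE q (r i))
    (hw : ∀ i, ∃ j, toE q (r j) = toE q (w⁻¹ * r i)) :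
    ∃ (κ : k) (N : ℤ), κ ≠ 0 ∧ w⁻¹ ^ n = q ^ N ∧ ∀ u : kˣ,
      ∏ i, Theta (q : k) ((r i : k)⁻¹ * (w * u)) =
        κ * (u : k) ^ N * ∏ i, Theta (q : k) ((r i : k)⁻¹ * u) := by
  choose π hπ using hw
  choose m hm using fun i => toE_eq_iff.mp (hπ i)
  choose κ hκ0 hκ using fun i => exists_Theta_zpow_mul (L := k) hq (-m i)
  have hπi : Function.Injective π := by
    intro i j hij
    have h := hπ i
    rw [hij, hπ j, map_mul, map_mul] at h
    exact (hri (mul_left_cancel h)).symm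
  have hπb : Function.Bijective π := Finite.injective_iff_bijective.mp hπi
  refine ⟨∏ i, (κ i * (r (π i) : k)⁻¹ ^ m i), ∑ i, m i,
    Finset.prod_ne_zero_iff.mpr fun i _ => mul_ne_zero (hκ0 i) (zpow_ne_zero _ (by simp)), ?_, ?_⟩
  · have h1 : ∏ i, (w⁻¹ * r i) = ∏ i, (r (π i) * q ^ m i) := Finset.prod_congr rfl fun i _ => hm i
    rw [Finset.prod_mul_distrib, Finset.prod_mul_distrib, hπb.prod_comp r, Finset.prod_const,
      Finset.card_univ, Fintype.card_fin, mul_comm, ← zpow_sum] at h1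
    exact mul_left_cancel h1
  · intro u
    have h1 : ∀ i, Theta (q : k) ((r i : k)⁻¹ * (w * u)) = κ i * (r (π i) : k)⁻¹ ^ m i *
        (u : k) ^ m i * Theta (q : k) ((r (π i) : k)⁻¹ * u) := by
      intro i
      have h2 : (r i : k)⁻¹ * (w * u) = (q : k) ^ (-m i) * ((r (π i) : k)⁻¹ * u) := by
        have h3 : (r i : k) = w * (r (π i) * (q : k) ^ m i) := by
          simpa using congrArg Units.val (inv_mul_eq_iff_eq_mul.mp (hm i))
        rw [h3, zpow_neg, mul_inv, mul_inv]
        have := w.ne_zero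
        field_simp
      rw [h2]
      refine (hκ i _ (by simp)).trans ?_
      simp only [Algebra.algebraMap_self, RingHom.id_apply, neg_neg, mul_zpow]
      ring
    rw [Finset.prod_congr rfl fun i _ => h1 i, Finset.prod_mul_distrib, Finset.prod_mul_distrib,
      hπb.prod_comp fun i => Theta (q : k) ((r i : k)⁻¹ * u)]
    congr 2
    simpa using (congrArg Units.val (zpow_sum u m)).symm

theorem exists_thetaQuotient_translate (hq : ‖(q : k)‖ < 1) {n : ℕ} {r g : Fin n → kˣ} {w : kˣ}
    (hri : Function.Injective fun i => toE q (r i)) (hgi : Function.Injective fun i => toE q (g i))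
    (hrw : ∀ i, ∃ j, toE q (r j) = toE q (w⁻¹ * r i))
    (hgw : ∀ i, ∃ j, toE q (g j) = toE q (w⁻¹ * g i)) :
    ∃ c : kˣ, ∀ u : kˣ, thetaQuotient q r g (w * u) = c * thetaQuotient q r g (u : k) := by
  obtain ⟨κ, N, hκ, hN, h⟩ := exists_prod_Theta_translate hq hri hrw
  obtain ⟨κ', N', hκ', hN', h'⟩ := exists_prod_Theta_translate hq hgi hgw
  have hNN : N = N' := by
    have h1 : ‖(q : k)‖ ^ N = ‖(q : k)‖ ^ N' := by
      rw [← norm_zpow, ← norm_zpow, ← Units.val_zpow_eq_zpow_val, ← Units.val_zpow_eq_zpow_val,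
        ← hN, ← hN']
    exact zpow_right_injective₀ (norm_pos_iff.mpr q.ne_zero) hq.ne h1
  subst hNN
  refine ⟨Units.mk0 (κ / κ') (div_ne_zero hκ hκ'), fun u => ?_⟩
  rw [thetaQuotient_eq, thetaQuotient_eq, h, h', Units.val_mk0, mul_right_comm κ,
    mul_right_comm κ', mul_div_mul_right _ _ (zpow_ne_zero _ u.ne_zero), mul_div_mul_comm]

end Translation

/-! ### Cosets of division points -/

section Cosets

variable {k : Type u} [NontriviallyNormedField k] {q : kˣ}

theorem exists_mem_cosetPoints_iff {G : Subgroup (E q)} {n : ℕ} (hn : Nat.card G = n)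
    {γ : CosetGroup q n G} (hγ : γ ≠ 1) :
    ∃ P₀, P₀ ∉ G ∧ ∀ P, P ∈ cosetPoints γ ↔ P₀⁻¹ * P ∈ G := by
  obtain ⟨⟨P₀, h₀⟩, rfl⟩ := QuotientGroup.mk_surjective γ
  refine ⟨P₀, fun h => hγ ((QuotientGroup.eq_one_iff _).mpr h), fun P => ⟨?_, fun h => ?_⟩⟩
  · rintro ⟨h, e⟩
    exact (QuotientGroup.eq (s := G.subgroupOf (divisionPoints q n))).mp e.symm
  · have hG : P₀⁻¹ * P ∈ divisionPoints q n := by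
      have := pow_card_eq_one' (x := (⟨_, h⟩ : G))
      rw [hn] at this
      exact congrArg Subtype.val this
    have hP : P ∈ divisionPoints q n := by
      have := mul_mem h₀ hG
      rwa [mul_inv_cancel_left] at this
    exact ⟨hP, ((QuotientGroup.eq (s := G.subgroupOf (divisionPoints q n))).mpr h).symm⟩

theorem injective_of_range_eq {ι α : Type*} [Finite ι] {f : ι → α} {S : Set α}
    (h : Set.range f = S) (hc : Nat.card S = Nat.card ι) : Function.Injective f := by
  subst h
  have h1 := Set.rangeFactorization_surjective (f := f)
  have h2 := (h1.bijective_of_nat_card_le hc.ge).injective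
  exact fun x y hxy => h2 (Subtype.ext hxy)

end Cosets

end

end TateJacobi

/-! ### The theorem. -/

theorem theorem5 {k : Type u} [NontriviallyNormedField k] [IsUltrametricDist k] [CompleteSpace k]
    [Valuation.IsRankOneDiscrete (NormedField.valuation (K := k))]
    (q : kˣ) (hq : ‖(q : k)‖ < 1)
    (G : Subgroup (TateJacobi.E q)) [Finite G]
    (n : ℕ) (hn : Nat.card G = n) (hchar : (n : k) ≠ 0)
    (γ : TateJacobi.CosetGroup q n G) (hγ : γ ≠ 1)
    (g r : Fin n → kˣ)
    (hg : Set.range (fun i => TateJacobi.toE q (g i)) = (G : Set (TateJacobi.E q)))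
    (hr : Set.range (fun i => TateJacobi.toE q (r i)) = TateJacobi.cosetPoints γ)
    (hprod : ∏ i, r i = ∏ i, g i) :
    (∀ u : kˣ, TateJacobi.thetaQuotient q r g (q * u) = TateJacobi.thetaQuotient q r g (u : k)) ∧
    ∃ (R : TateJacobi.RationalFunctions (q : k)) (χ : G →* kˣ),
      TateJacobi.IsPullback q k R (TateJacobi.thetaQuotient q r g) ∧
      TateJacobi.IsJacobiFunction q G χ R ∧
      TateJacobi.HasDivisor q R
        (-TateJacobi.sumOfPoints (G : Set (TateJacobi.E q)) +
          TateJacobi.sumOfPoints (TateJacobi.cosetPoints γ)) := by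
  open TateJacobi in
  refine ⟨thetaQuotient_mul hq hprod, ?_⟩
  obtain ⟨P₀, hP₀, hγP⟩ := exists_mem_cosetPoints_iff hn hγ
  have hgi : Function.Injective fun i => toE q (g i) :=
    injective_of_range_eq hg (by rw [Nat.card_fin]; exact hn)
  have hri : Function.Injective fun i => toE q (r i) := by
    refine injective_of_range_eq hr ?_
    rw [Nat.card_fin]
    -- Translation by `P₀⁻¹` maps `γ` onto `G`, so `γ` has `n` points and the `r i` represent
    -- distinct classes.
    refine Eq.trans (Nat.card_congr (β := G) ⟨fun P => ⟨_, (hγP P).mp P.2⟩,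
      fun P => ⟨P₀ * P, (hγP _).mpr (by simp)⟩, fun P => by simp, fun P => by simp⟩) hn
  have hgG : ∀ i, toE q (g i) ∈ G := fun i => hg.subset ⟨i, rfl⟩
  have hrγ : ∀ i, P₀⁻¹ * toE q (r i) ∈ G := fun i => (hγP _).mp (hr.subset ⟨i, rfl⟩)
  have hrg : ∀ i j, toE q (r i) ≠ toE q (g j) := by
    intro i j h
    have h1 := hrγ i
    rw [h] at h1
    exact hP₀ (by simpa using mul_mem (hgG j) (inv_mem h1))
  obtain ⟨R, hR0, hR⟩ := exists_isPullback_thetaRatio hq hrg hprod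
  have hRk := hR k
  rw [thetaRatio_self] at hRk
  have hord : ∀ (L : Type u) [NontriviallyNormedField L] [IsUltrametricDist L] [CompleteSpace L]
      [NormedAlgebra k L] (α : L), α ≠ 0 → meromorphicOrderAt (thetaRatio q L r g) α =
        ((coeffAt q L (-sumOfPoints (G : Set (E q)) + sumOfPoints (cosetPoints γ)) α : ℤ) :
          WithTop ℤ) := fun L _ _ _ _ α hα =>
    meromorphicOrderAt_thetaRatio hq hr hg hri hgi hrg hα
  have htrans : ∀ a : G, ∃ c : kˣ, ∀ w : kˣ, toE q w = a → ∀ u : kˣ,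
      thetaQuotient q r g (w * u) = c * thetaQuotient q r g (u : k) := by
    intro a
    obtain ⟨w₀, hw₀⟩ := toE_surjective (a : E q)
    have haG : toE q w₀⁻¹ ∈ G := by rw [map_inv, hw₀]; exact inv_mem a.2
    obtain ⟨c, hc⟩ := exists_thetaQuotient_translate (w := w₀) hq hri hgi
      (fun i => hr.superset ((hγP _).mpr (by
        rw [map_mul, mul_left_comm]; exact mul_mem haG (hrγ i))))
      (fun i => hg.superset (by rw [map_mul]; exact mul_mem haG (hgG i)))
    refine ⟨c, fun w hw u => ?_⟩
    -- Two lifts of the same point differ by a power of `q`, so periodicity makes the constant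
    -- independent of the lift.
    obtain ⟨m, rfl⟩ := toE_eq_iff.mp (hw₀.trans hw.symm)
    rw [← hc, mul_comm w₀, Units.val_mul, mul_assoc, ← Units.val_mul w₀,
      thetaQuotient_zpow_mul hq hprod]
  choose c hc using htrans
  -- A nonzero value of `f` allows cancellation, which forces the constants to be multiplicative in
  -- the point of `G`.
  obtain ⟨u₀, hu₀⟩ : ∃ u : kˣ, thetaQuotient q r g (u : k) ≠ 0 := by
    obtain ⟨h, ha, h0, he⟩ := exists_thetaRatio_eq_zpow_smul (L := k) hq hrg one_ne_zero
    obtain ⟨z, ⟨⟨hz, hz0⟩, hz1⟩, hz2⟩ := (((he.and (ha.continuousAt.eventually_ne h0)).and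
      (eventually_ne_nhds one_ne_zero)).filter_mono nhdsWithin_le_nhds |>.and
        (self_mem_nhdsWithin (s := {(1 : k)}ᶜ))).exists
    refine ⟨Units.mk0 z hz1, ?_⟩
    rw [← thetaRatio_self, Units.val_mk0, hz]
    exact smul_ne_zero (zpow_ne_zero _ (sub_ne_zero.mpr hz2)) hz0
  let χ : G →* kˣ := MonoidHom.mk' c fun a b => by
    obtain ⟨v, hv⟩ := toE_surjective (a : E q)
    obtain ⟨w, hw⟩ := toE_surjective (b : E q)
    have h1 := hc (a * b) (v * w) (by rw [map_mul, hv, hw]; rfl) u₀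
    rw [Units.val_mul, mul_assoc, ← Units.val_mul w, hc a v hv, Units.val_mul, hc b w hw,
      ← mul_assoc] at h1
    exact Units.ext (mul_right_cancel₀ hu₀ h1).symm
  refine ⟨R, χ, hRk, ⟨hR0, fun L _ _ _ _ => ⟨_, hR L, fun α hα => ?_⟩, _, hRk, hc⟩,
    fun L _ _ _ _ => ⟨_, hR L, hord L⟩⟩
  rw [hord L α hα, coeffAt_add]
  exact WithTop.coe_le_coe.mpr (le_add_of_nonneg_right (coeffAt_sumOfPoints_nonneg _ α))
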